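/- Let $\mathbb{Z}^2_{\mathrm{even}}=\{(x,t)\in\mathbb{Z}^2 : x+t \text{ even}\}$. In the dynamical discrete web, every site $(x,t)\in\mathbb{Z}^2_{\mathrm{even}}$ carries an arrow $\xi^\tau_{(x,t)}\in\{+1,-1\}$ which depends on a dynamical time $\tau\ge 0$: initially it is a fair random sign, and at each ring of a rate one Poisson clock attached to the site it is replaced by a new fair random sign; all clocks and all signs are independent. Let $S_0^\tau(t)$, $t\in[0,\infty)$, be the path that starts at $(0,0)$ and follows the arrows from $(x,t)$ to $(x+\xi^\tau_{(x,t)},t+1)$ (linearly between integer times). For an integer $j\ge 0$ and $K\in\mathbb{R}$ put $$T_j^{\pm}(K)=\{\tau\in[0,\infty) : |S_0^\tau(t)|\le j+K\sqrt t \ \text{ for all } t\ge 0\},\qquad T_\infty^{\pm}(K)=\bigcup_{j\ge 0}T_j^{\pm}(K).$$ For every $j$ and $K$ the Hausdorff dimensions $\dim_H T_j^{\pm}(K)$ and $\dim_H T_\infty^{\pm}(K)$ are almost surely equal to constants. Denoting these constants by the same symbols, for every $K\in\mathbb{R}$, $$\sup_{K'<K}\dim_H T_\infty^{\pm}(K')\le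 \dim_H T_1^{\pm}(K)\le \dim_H T_\infty^{\pm}(K)\le \inf_{K''>K}\dim_H T_1^{\pm}(K'').$$ Consequently, for all but countably many $K$, one has $\dim_H T_j^{\pm}(K)=\dim_H T_\infty^{\pm}(K)$ for all integers $j\ge 1$. -/

import Mathlib

open MeasureTheory ProbabilityTheory Set
open scoped ENNReal

namespace DiscreteWeb

/-- The even sublattice of `ℤ²`: space-time points `(x, t)` with `x + t` even. -/
abbrev Site : Type := {p : ℤ × ℤ // Even (p.1 + p.2)}

/-- The space-time origin. -/
def origin : Site := ⟨(0, 0), by decide⟩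

/-- An arrow configuration: each site carries an arrow `+1` or `-1`. -/
abbrev Config : Type := Site → ℤˣ

/-- The head `(x + ξ, t + 1)` of the arrow that starts at `(x, t)`. -/
def next (ξ : Config) (z : Site) : Site :=
  ⟨(z.1.1 + (ξ z : ℤ), z.1.2 + 1), by
    have h := z.2
    rcases Int.units_eq_one_or (ξ z) with h1 | h1 <;> rw [h1] <;>
      simp only [Units.val_one, Units.val_neg] <;> grind⟩

/-- The site reached from `z` after following `n` arrows. -/
def walk (ξ : Config) (z : Site) : ℕ → Site
  | 0 => z
  | n + 1 => next ξ (walk ξ z n)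

/-- The position at real time `t` (not before the time of `z`) of the path that starts at `z` and
follows the arrows; between integer times the path runs linearly along the arrow. -/
noncomputable def path (ξ : Config) (z : Site) (t : ℝ) : ℝ :=
  let n : ℕ := ⌊t - (z.1.2 : ℝ)⌋₊
  ((walk ξ z n).1.1 : ℝ) + (t - (z.1.2 : ℝ) - (n : ℝ)) * (((ξ (walk ξ z n) : ℤˣ) : ℤ) : ℝ)

/-- The randomness driving a dynamical discrete web on a probability space: at each site a rate one
Poisson clock, given by its i.i.d. exponential waiting times, and an i.i.d. sequence of fair signs
(the initial arrow, followed by the arrow chosen at the first ring, at the second ring, ...);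
everything is independent. -/
structure DynamicalWeb {Ω : Type*} [MeasurableSpace Ω] (P : Measure Ω) where
  /-- waiting time between ring number `n` and ring number `n + 1` (time `0` for `n = 0`) -/
  wait : Site → ℕ → Ω → ℝ
  /-- the arrow in force after exactly `n` rings -/
  mark : Site → ℕ → Ω → ℤˣ
  measurable_wait : ∀ z n, Measurable (wait z n)
  measurable_mark : ∀ z n, Measurable (mark z n)
  law_wait : ∀ z n, P.map (wait z n) = expMeasure 1
  law_mark : ∀ z n (u : ℤˣ), P {ω | mark z n ω = u} = 1 / 2
  indep_wait_mark : ∀ z n, IndepFun (wait z n) (mark z n) P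
  indep : iIndepFun (fun (p : Site × ℕ) (ω : Ω) => (wait p.1 p.2 ω, mark p.1 p.2 ω)) P

namespace DynamicalWeb

variable {Ω : Type*} [MeasurableSpace Ω] {P : Measure Ω}

/-- The dynamical time of ring number `n + 1` of the clock at `z`. -/
def ringTime (W : DynamicalWeb P) (z : Site) (n : ℕ) (ω : Ω) : ℝ :=
  ∑ i ∈ Finset.range (n + 1), W.wait z i ω

/-- The number of rings of the clock at `z` up to and including dynamical time `τ`. -/
noncomputable def ringCount (W : DynamicalWeb P) (z : Site) (τ : ℝ) (ω : Ω) : ℕ :=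
  {n : ℕ | W.ringTime z n ω ≤ τ}.ncard

/-- The arrow configuration at dynamical time `τ`. -/
noncomputable def arrows (W : DynamicalWeb P) (τ : ℝ) (ω : Ω) : Config :=
  fun z => W.mark z (W.ringCount z τ ω) ω

/-- The path from the origin at dynamical time `τ`. -/
noncomputable def S₀ (W : DynamicalWeb P) (τ : ℝ) (ω : Ω) (t : ℝ) : ℝ :=
  path (W.arrows τ ω) origin t

/-- The dynamical times `τ ≥ 0` with `|S₀^τ(t)| ≤ j + K √t` for all `t ≥ 0`. -/
def T (W : DynamicalWeb P) (j : ℕ) (K : ℝ) (ω : Ω) : Set ℝ :=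
  {τ | 0 ≤ τ ∧ ∀ t : ℝ, 0 ≤ t → |W.S₀ τ ω t| ≤ j + K * √t}

/-- The union of the sets `T j K` over all `j ≥ 0`. -/
def TInf (W : DynamicalWeb P) (K : ℝ) (ω : Ω) : Set ℝ :=
  ⋃ j : ℕ, W.T j K ω

end DynamicalWeb

end DiscreteWeb

namespace DiscreteWeb

/-! The heart of the matter is the comparison `d j K ≤ d 1 K'` for `K < K'`, proved in
`Clocks.dimH_confined_le`. An additive constant `j` is absorbed by a steeper parabola once `t ≥ 2m`
with `j ≤ (K' - K) √(2m)`. So let the path zigzag between `0` and `1` for its first `2m` steps,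
where the bound `1` suffices, and then follow a translated web whose path is confined with constants
`j`, `K` (`mem_confined_of_zigzag`). The zigzag involves finitely many arrows. With positive
probability none of them changes during a given bounded interval `[0, M]` of dynamical time, and
this is independent of the translated web. Hence with positive probability the dimension for `(1,
K')` is at least that for `(j, K)` on `[0, M]`. Both dimensions are almost surely constant, so an
event of positive probability already compares the constants.

Almost sure constancy comes from shifting dynamical time. By memorylessness the shift preserves the
law of the clocks, and it is mixing enough that invariant events are trivial
(`Clocks.measure_eq_zero_or_one`). The dimension can only decrease under the shift while its
integral is preserved, so it is invariant (`Clocks.exists_ae_eq_const`). This requires measurability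
of the dimension. The set of times is replaced by a compact one differing from it only by countably
many ring times, and null Hausdorff measure of a compact set is tested by finite rational covers.

Finally `dInf K` is the supremum of `d j K` over `j`, by countable stability of Hausdorff dimension.
The chain of inequalities follows, and all the constants with `j ≥ 1` agree wherever the monotone
function `d 1` is continuous. -/

/-- Disjoint subfamilies of an independent family are independent. -/
theorem indepFun_of_disjoint_range {Ω ι α β E : Type*} {mΩ : MeasurableSpace Ω}
    {P : Measure Ω} [MeasurableSpace E] {X : ι → Ω → E} (hX : ∀ i, Measurable (X i))
    (h : iIndepFun X P) {f : α → ι} {g : β → ι} (hfg : ∀ a b, f a ≠ g b) :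
    IndepFun (fun ω a => X (f a) ω) (fun ω b => X (g b) ω) P := by
  have h1 := indep_iSup_of_disjoint (m := fun i => MeasurableSpace.comap (X i) inferInstance)
    (fun i => (hX i).comap_le) h (S := range f) (T := range g)
    (by rw [Set.disjoint_left]; rintro _ ⟨a, rfl⟩ ⟨b, hb⟩; exact hfg a b hb.symm)
  rw [IndepFun_iff_Indep]
  refine indep_of_indep_of_le_left (indep_of_indep_of_le_right h1 ?_) ?_
  · rw [← measurable_iff_comap_le, @measurable_pi_iff]
    intro b
    rw [measurable_iff_comap_le]
    exact le_iSup₂_of_le (g b) (mem_range_self b) le_rfl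
  · rw [← measurable_iff_comap_le, @measurable_pi_iff]
    intro b
    rw [measurable_iff_comap_le]
    exact le_iSup₂_of_le (f b) (mem_range_self b) le_rfl

/-! ### Exponential waiting times. -/

theorem expMeasure_memoryless {c : ℝ} (hc : 0 ≤ c) {B : Set ℝ} (hB : MeasurableSet B) :
    expMeasure 1 {w | c < w ∧ w - c ∈ B} = ENNReal.ofReal (Real.exp (-c)) * expMeasure 1 B := by
  have hS : MeasurableSet {w : ℝ | c < w ∧ w - c ∈ B} :=
    measurableSet_Ioi.inter (hB.preimage (measurable_id.sub_const c))
  have hm : Measurable (exponentialPDF 1) :=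
    (measurable_exponentialPDFReal 1).ennreal_ofReal
  have key : ∀ S : Set ℝ, MeasurableSet S →
      expMeasure 1 S = ∫⁻ w, S.indicator (exponentialPDF 1) w := by
    intro S hS
    rw [lintegral_indicator hS]
    exact withDensity_apply _ hS
  rw [key _ hS, key _ hB, ← lintegral_add_right_eq_self _ c,
    ← lintegral_const_mul _ (hm.indicator hB)]
  apply lintegral_congr_ae
  -- After translation by `c` the two integrands can differ at `w = 0`, where the strict inequality
  -- fails but the density does not vanish.
  have h0 : ∀ᵐ w : ℝ, w ≠ 0 := by
    rw [ae_iff]; simp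
  filter_upwards [h0] with w hw
  by_cases hwB : w ∈ B
  · rcases lt_or_gt_of_ne hw with h | h
    · rw [indicator_of_notMem, indicator_of_mem hwB, exponentialPDF_of_neg h, mul_zero]
      simp only [mem_ofPred_eq, not_and]; intro h2; linarith
    · rw [indicator_of_mem, indicator_of_mem hwB, exponentialPDF_of_nonneg (by linarith),
        exponentialPDF_of_nonneg h.le, ← ENNReal.ofReal_mul (Real.exp_pos _).le]
      · congr 1
        rw [one_mul, one_mul, one_mul, one_mul, ← Real.exp_add]; congr 1; ring
      · simp only [mem_ofPred_eq, add_sub_cancel_right]; exact ⟨by linarith, hwB⟩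
  · rw [indicator_of_notMem, indicator_of_notMem hwB, mul_zero]
    simp only [mem_ofPred_eq, add_sub_cancel_right]; exact fun h => hwB h.2

instance : IsProbabilityMeasure (expMeasure 1) := isProbabilityMeasure_expMeasure one_pos

theorem expMeasure_Ioi {c : ℝ} (hc : 0 ≤ c) :
    expMeasure 1 (Ioi c) = ENNReal.ofReal (Real.exp (-c)) := by
  have h := expMeasure_memoryless hc MeasurableSet.univ
  simpa [Ioi] using h

/-! ### The deterministic clock at one site. -/

/-- The successive waiting times and marks at one site. -/
abbrev Clock : Type := ℕ → ℝ × ℤˣ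

namespace Clock

/-- The sum of the first `k` waiting times. -/
def time (e : Clock) (k : ℕ) : ℝ := ∑ i ∈ Finset.range k, (e i).1

/-- The number of rings up to time `a`. -/
noncomputable def count (a : ℝ) (e : Clock) : ℕ := sInf {k | a < e.time (k + 1)}

/-- The clock seen from time `a`, when `k` rings have occurred by then. -/
noncomputable def restart (a : ℝ) (k : ℕ) (e : Clock) : Clock :=
  fun i => if i = 0 then ((e k).1 - (a - e.time k), (e k).2) else e (k + i)

/-- The clock seen from time `a`. -/
noncomputable def shift (a : ℝ) (e : Clock) : Clock := restart a (count a e) e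

/-- The mark in force at time `a`. -/
noncomputable def mark (e : Clock) (a : ℝ) : ℤˣ := (e (count a e)).2

/-- Positive waiting times and unbounded ring times. -/
def Good (e : Clock) : Prop := (∀ i, 0 < (e i).1) ∧ ∀ a : ℝ, ∃ k, a < e.time k

/-- The law of the clock at one site. -/
noncomputable def law (u : Measure ℤˣ) : Measure Clock :=
  Measure.infinitePi fun _ : ℕ => (expMeasure 1).prod u

theorem time_zero (e : Clock) : e.time 0 = 0 := by simp [time]

theorem time_succ (e : Clock) (k : ℕ) : e.time (k + 1) = e.time k + (e k).1 :=
  Finset.sum_range_succ _ _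

@[fun_prop]
theorem measurable_time (k : ℕ) : Measurable fun e : Clock => e.time k := by
  unfold time; fun_prop

@[fun_prop]
theorem measurable_count (a : ℝ) : Measurable (count a) := by
  refine measurable_to_countable' fun n => ?_
  have hE : ∀ k : ℕ, MeasurableSet {e : Clock | a < e.time (k + 1)} := fun k =>
    measurableSet_lt measurable_const (measurable_time _)
  -- The second set accounts for the convention `sInf ∅ = 0`.
  have : count a ⁻¹' {n} =
      ({e : Clock | a < e.time (n + 1)} ∩ ⋂ k ∈ Iio n, {e : Clock | a < e.time (k + 1)}ᶜ) ∪
      {e : Clock | n = 0 ∧ ∀ k, ¬ a < e.time (k + 1)} := by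
    ext e
    simp only [mem_preimage, mem_singleton_iff, mem_union, mem_inter_iff, mem_ofPred_eq, mem_iInter,
      mem_compl_iff, mem_Iio, count]
    constructor
    · intro h
      by_cases hne : ∃ k, a < e.time (k + 1)
      · left
        have h1 : sInf {k | a < e.time (k + 1)} ∈ {k | a < e.time (k + 1)} := Nat.sInf_mem hne
        rw [h] at h1
        exact ⟨h1, fun k hk hk' => (Nat.notMem_of_lt_sInf (by rw [h]; exact hk)) hk'⟩
      · right
        push Not at hne
        refine ⟨?_, fun k => not_lt.2 (hne k)⟩
        rw [← h]
        have : {k | a < e.time (k + 1)} = ∅ := by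
          ext k; simpa using hne k
        rw [this, Nat.sInf_empty]
    · rintro (⟨h1, h2⟩ | ⟨h1, h2⟩)
      · apply le_antisymm (Nat.sInf_le h1)
        by_contra hlt
        push Not at hlt
        exact h2 _ hlt (Nat.sInf_mem (s := {k | a < e.time (k + 1)}) ⟨n, h1⟩)
      · have : {k | a < e.time (k + 1)} = ∅ := by
          ext k; simpa using h2 k
        rw [this, Nat.sInf_empty, h1]
  rw [this]
  refine ((hE n).inter (MeasurableSet.biInter (to_countable _) fun k _ => (hE k).compl)).union ?_
  by_cases hn : n = 0
  · simp only [hn, true_and, ofPred_forall]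
    exact MeasurableSet.iInter fun k => (hE k).compl
  · simp [hn]

theorem Good.strictMono {e : Clock} (h : e.Good) : StrictMono e.time :=
  strictMono_nat_of_lt_succ fun k => by rw [time_succ]; linarith [h.1 k]

theorem Good.count_eq_iff {e : Clock} (h : e.Good) {a : ℝ} (ha : 0 ≤ a) {k : ℕ} :
    count a e = k ↔ e.time k ≤ a ∧ a < e.time (k + 1) := by
  have hne : ∃ k, a < e.time (k + 1) := by
    obtain ⟨k, hk⟩ := h.2 a
    exact ⟨k, hk.trans (h.strictMono (Nat.lt_succ_self k))⟩
  have h1 : a < e.time (count a e + 1) := Nat.sInf_mem hne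
  have h2 : e.time (count a e) ≤ a := by
    rcases hc : count a e with _ | m
    · rwa [time_zero]
    · have : m ∉ {k | a < e.time (k + 1)} := Nat.notMem_of_lt_sInf (by
        have : sInf {k | a < e.time (k + 1)} = m + 1 := hc
        omega)
      simpa using this
  constructor
  · rintro rfl; exact ⟨h2, h1⟩
  · rintro ⟨h3, h4⟩
    have h5 : count a e < k + 1 := h.strictMono.lt_iff_lt.1 (h2.trans_lt h4)
    have h6 : k < count a e + 1 := h.strictMono.lt_iff_lt.1 (h3.trans_lt h1)
    omega

theorem Good.count_spec {e : Clock} (h : e.Good) {a : ℝ} (ha : 0 ≤ a) :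
    e.time (count a e) ≤ a ∧ a < e.time (count a e + 1) := (h.count_eq_iff ha).1 rfl

/-- Links the cardinality that defines `ringCount` with the infimum used here; on good clocks the
rings up to `a` form an initial segment. -/
theorem Good.ncard_eq_count {e : Clock} (h : e.Good) {a : ℝ} (ha : 0 ≤ a) :
    {n : ℕ | e.time (n + 1) ≤ a}.ncard = count a e := by
  have : {n : ℕ | e.time (n + 1) ≤ a} = Iio (count a e) := by
    ext n
    obtain ⟨h1, h2⟩ := h.count_spec ha
    constructor
    · intro hn
      have : n + 1 < count a e + 1 := h.strictMono.lt_iff_lt.1 (lt_of_le_of_lt hn h2)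
      simpa using this
    · intro hn
      exact (h.strictMono.monotone (Nat.succ_le_of_lt hn)).trans h1
  rw [this, Set.ncard_eq_toFinset_card']; simp

theorem time_restart (a : ℝ) (k j : ℕ) (e : Clock) :
    (restart a k e).time (j + 1) = e.time (k + (j + 1)) - a := by
  induction j with
  | zero => rw [time_succ, time_zero, ← add_assoc, time_succ]; simp [restart]; ring
  | succ j ih => rw [time_succ, ih, show k + (j + 1 + 1) = k + (j + 1) + 1 from rfl, time_succ]; simp [restart]; ring

theorem Good.shift {e : Clock} (h : e.Good) {a : ℝ} (ha : 0 ≤ a) : (Clock.shift a e).Good := by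
  constructor
  · intro i
    rcases Nat.eq_zero_or_pos i with rfl | hi
    · have := (h.count_spec ha).2
      rw [time_succ] at this
      simp only [Clock.shift, restart, if_true]; linarith
    · simp only [Clock.shift, restart, hi.ne', if_false]; exact h.1 _
  · intro b
    obtain ⟨k, hk⟩ := h.2 (b + a)
    refine ⟨k + 1, ?_⟩
    rw [Clock.shift, time_restart]
    have := h.strictMono.monotone (show k ≤ count a e + (k + 1) by omega)
    linarith

/-- The indices of the two clocks differ by the number of rings up to `a`. Index `0` of the
restarted clock keeps the mark already in force, so no mark is lost. -/
theorem Good.mark_shift {e : Clock} (h : e.Good) {a t : ℝ} (ha : 0 ≤ a) (ht : 0 ≤ t) :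
    (Clock.shift a e).mark t = e.mark (a + t) := by
  obtain ⟨h1, h2⟩ := h.count_spec ha
  obtain ⟨h3, h4⟩ := h.count_spec (add_nonneg ha ht)
  have hle : count a e ≤ count (a + t) e := by
    have : count a e < count (a + t) e + 1 := h.strictMono.lt_iff_lt.1 (by linarith)
    omega
  obtain ⟨l, hl⟩ := Nat.exists_eq_add_of_le hle
  have hc : count t (Clock.shift a e) = l := by
    rw [(h.shift ha).count_eq_iff ht]
    rw [hl] at h3 h4
    refine ⟨?_, ?_⟩
    · rcases l with _ | l
      · rwa [time_zero]
      · rw [Clock.shift, time_restart]; linarith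
    · rw [Clock.shift, time_restart, ← add_assoc]; linarith
  unfold mark
  rw [hc, hl, Clock.shift, restart]
  split_ifs with h0 <;> simp [h0]

@[fun_prop]
theorem measurable_restart (a : ℝ) (k : ℕ) : Measurable (restart a k) := by
  refine measurable_pi_lambda _ fun i => ?_
  unfold restart
  split_ifs <;> fun_prop

@[fun_prop]
theorem measurable_shift (a : ℝ) : Measurable (shift a) :=
  (measurable_from_prod_countable_right (f := fun p : ℕ × Clock => restart a p.1 p.2)
    fun k => measurable_restart a k).comp ((measurable_count a).prodMk measurable_id)

@[fun_prop]
theorem measurable_mark (a : ℝ) : Measurable fun e : Clock => e.mark a :=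
  (measurable_from_prod_countable_right (f := fun p : ℕ × Clock => (p.2 p.1).2)
    fun k => by fun_prop).comp ((measurable_count a).prodMk measurable_id)

end Clock

/-! ### Boxes in infinite product measures. -/

section Box

variable {ι : Type*} {X : ι → Type*} {mX : ∀ i, MeasurableSpace (X i)} (μ : ∀ i, Measure (X i))
  [∀ i, IsProbabilityMeasure (μ i)]

theorem univ_pi_eq_pi_of_univ {s : Finset ι} {t : ∀ i, Set (X i)} (h : ∀ i ∉ s, t i = univ) :
    Set.pi univ t = Set.pi (s : Set ι) t := by
  classical
  ext x
  simp only [Set.mem_pi, Finset.mem_coe]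
  exact ⟨fun hx i _ => hx i (mem_univ i),
    fun hx i _ => if hi : i ∈ s then hx i hi else by simp [h i hi]⟩

theorem measurableSet_univ_pi_of_univ {s : Finset ι} {t : ∀ i, Set (X i)}
    (ht : ∀ i, MeasurableSet (t i)) (h : ∀ i ∉ s, t i = univ) :
    MeasurableSet (Set.pi univ t) := by
  rw [univ_pi_eq_pi_of_univ h]
  exact MeasurableSet.pi s.countable_toSet fun i _ => ht i

theorem infinitePi_univ_pi {s : Finset ι} {t : ∀ i, Set (X i)} (ht : ∀ i, MeasurableSet (t i))
    (h : ∀ i ∉ s, t i = univ) :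
    Measure.infinitePi μ (Set.pi univ t) = ∏ i ∈ s, μ i (t i) := by
  rw [univ_pi_eq_pi_of_univ h, Measure.infinitePi_pi _ fun i _ => ht i]

/-- To identify a product measure it suffices to test boxes restricting all coordinates of a given
finite set. -/
theorem eq_infinitePi_of_boxes (s₀ : Finset ι) {ν : Measure (∀ i, X i)}
    (hν : ∀ s : Finset ι, s₀ ⊆ s → ∀ t : ∀ i, Set (X i), (∀ i, MeasurableSet (t i)) →
      (∀ i ∉ s, t i = univ) → ν (Set.pi univ t) = ∏ i ∈ s, μ i (t i)) :
    ν = Measure.infinitePi μ := by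
  classical
  refine Measure.eq_infinitePi _ fun s t ht => ?_
  let t' : ∀ i, Set (X i) := fun i => if i ∈ s then t i else univ
  have ht' : ∀ i, MeasurableSet (t' i) := fun i => by
    simp only [t']; split_ifs; exacts [ht i, MeasurableSet.univ]
  have h1 : ∀ i ∉ s, t' i = univ := fun i hi => by simp [t', hi]
  have h2 : Set.pi (s : Set ι) t = Set.pi univ t' := by
    rw [univ_pi_eq_pi_of_univ h1]
    exact Set.pi_congr rfl fun i hi => by simp [t', Finset.mem_coe.1 hi]
  rw [h2, hν (s₀ ∪ s) Finset.subset_union_left t' ht' fun i hi =>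
    h1 i fun h => hi (Finset.mem_union_right _ h)]
  rw [← Finset.prod_subset (Finset.subset_union_right (s₁ := s₀)) fun i _ hi => by
    rw [h1 i hi, measure_univ]]
  exact Finset.prod_congr rfl fun i hi => by simp [t', hi]

/-- A coordinatewise map that is, in each coordinate, conditionally measure preserving on an event
is conditionally measure preserving on the product of these events. -/
theorem infinitePi_inter_preimage_eq_mul {f : ∀ i, X i → X i} (hf : ∀ i, Measurable (f i))
    {D : ∀ i, Set (X i)} (hD : ∀ i, MeasurableSet (D i)) {F : Finset ι}
    (hDF : ∀ i ∉ F, D i = univ)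
    (h : ∀ i B, MeasurableSet B → μ i (D i ∩ f i ⁻¹' B) = μ i (D i) * μ i B)
    {B : Set (∀ i, X i)} (hB : MeasurableSet B) :
    Measure.infinitePi μ (Set.pi univ D ∩ (fun x i => f i (x i)) ⁻¹' B) =
      Measure.infinitePi μ (Set.pi univ D) * Measure.infinitePi μ B := by
  classical
  set M := Measure.infinitePi μ
  have hDm : MeasurableSet (Set.pi univ D) := measurableSet_univ_pi_of_univ hD hDF
  have hfm : Measurable fun (x : ∀ i, X i) i => f i (x i) := by fun_prop
  by_cases h0 : M (Set.pi univ D) = 0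
  · rw [h0, zero_mul]
    exact measure_mono_null inter_subset_left h0
  have hT : M (Set.pi univ D) ≠ ∞ := measure_ne_top _ _
  -- The law conditioned on the box and pushed through the coordinate maps has the right mass on all
  -- boxes large enough to contain `F`, so it is the product measure itself.
  have key : (M (Set.pi univ D))⁻¹ • (M.restrict (Set.pi univ D)).map (fun x i => f i (x i)) = M := by
    refine eq_infinitePi_of_boxes μ F fun s hFs t ht hts => ?_
    have hm := measurableSet_univ_pi_of_univ ht hts
    rw [Measure.smul_apply, Measure.map_apply hfm hm, Measure.restrict_apply (hfm hm), smul_eq_mul]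
    have hset : (fun (x : ∀ i, X i) i => f i (x i)) ⁻¹' (Set.pi univ t) ∩ Set.pi univ D =
        Set.pi univ fun i => D i ∩ f i ⁻¹' t i := by
      ext x; simp only [mem_inter_iff, mem_preimage, mem_univ_pi]
      exact ⟨fun h i => ⟨h.2 i, h.1 i⟩, fun h => ⟨fun i => (h i).2, fun i => (h i).1⟩⟩
    rw [hset, infinitePi_univ_pi μ (s := s) (fun i => (hD i).inter (hf i (ht i)))
      fun i hi => by simp [hDF i fun h => hi (hFs h), hts i hi]]
    simp_rw [fun i => h i (t i) (ht i)]
    rw [Finset.prod_mul_distrib, ← mul_assoc,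
      ← infinitePi_univ_pi μ (s := s) hD fun i hi => hDF i fun h => hi (hFs h),
      ENNReal.inv_mul_cancel h0 hT, one_mul]
  have hB' : M B = _ := (congrArg (fun ν => ν B) key).symm
  rw [hB', Measure.smul_apply, Measure.map_apply hfm hB, Measure.restrict_apply (hfm hB),
    smul_eq_mul, ← mul_assoc, ENNReal.mul_inv_cancel h0 hT, one_mul, inter_comm]

end Box

/-! ### The renewal property at one site. -/

namespace Clock

theorem prod_memoryless {u : Measure ℤˣ} [SFinite u] {c : ℝ} (hc : 0 ≤ c) {B : Set (ℝ × ℤˣ)}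
    (hB : MeasurableSet B) :
    (expMeasure 1).prod u {p | c < p.1 ∧ (p.1 - c, p.2) ∈ B} =
      ENNReal.ofReal (Real.exp (-c)) * (expMeasure 1).prod u B := by
  have hS : MeasurableSet {p : ℝ × ℤˣ | c < p.1 ∧ (p.1 - c, p.2) ∈ B} :=
    (measurableSet_lt measurable_const measurable_fst).inter
      (hB.preimage (by fun_prop : Measurable fun p : ℝ × ℤˣ => (p.1 - c, p.2)))
  rw [Measure.prod_apply_symm hS, Measure.prod_apply_symm hB, ← lintegral_const_mul]
  · refine lintegral_congr fun v => ?_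
    exact expMeasure_memoryless hc (B := (fun x => (x, v)) ⁻¹' B)
      (hB.preimage (by fun_prop))
  · exact measurable_measure_prodMk_right hB

variable {u : Measure ℤˣ} [IsProbabilityMeasure u]

theorem prod_lt {c : ℝ} (hc : 0 ≤ c) :
    (expMeasure 1).prod u {p | c < p.1} = ENNReal.ofReal (Real.exp (-c)) := by
  simpa using prod_memoryless (u := u) hc MeasurableSet.univ

instance : IsProbabilityMeasure (law u) := by unfold law; infer_instance

theorem law_eval (i : ℕ) {S : Set (ℝ × ℤˣ)} (hS : MeasurableSet S) :
    law u {e | e i ∈ S} = (expMeasure 1).prod u S :=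
  (measurePreserving_eval_infinitePi (fun _ : ℕ => (expMeasure 1).prod u) i).measure_preimage
    hS.nullMeasurableSet

theorem iIndepFun_eval : iIndepFun (fun (i : ℕ) (e : Clock) => e i) (law u) :=
  iIndepFun_infinitePi (X := fun _ x => x) (by fun_prop)

/-- The residual clock, conditionally on the first waiting time exceeding `c`. -/
theorem law_memoryless {c : ℝ} (hc : 0 ≤ c) {B : Set Clock} (hB : MeasurableSet B) :
    law u {e | c < (e 0).1 ∧ restart c 0 e ∈ B} = ENNReal.ofReal (Real.exp (-c)) * law u B := by
  set q := ENNReal.ofReal (Real.exp (-c)) with hq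
  let D : ℕ → Set (ℝ × ℤˣ) := fun i => if i = 0 then {p | c < p.1} else univ
  let f : ℕ → ℝ × ℤˣ → ℝ × ℤˣ := fun i p => if i = 0 then (p.1 - c, p.2) else p
  have hD : ∀ i, MeasurableSet (D i) := fun i => by
    simp only [D]; split_ifs
    exacts [measurableSet_lt measurable_const measurable_fst, MeasurableSet.univ]
  have hf : ∀ i, Measurable (f i) := fun i => by
    simp only [f]; split_ifs <;> fun_prop
  have hDF : ∀ i ∉ ({0} : Finset ℕ), D i = univ := fun i hi => by
    simp only [Finset.mem_singleton] at hi; simp [D, hi]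
  have hD0 : ∀ S : Set (ℝ × ℤˣ), D 0 ∩ f 0 ⁻¹' S = {p | c < p.1 ∧ (p.1 - c, p.2) ∈ S} :=
    fun S => by ext p; simp [D, f]
  have hμ0 : (expMeasure 1).prod u (D 0) = q := by
    simpa [D, hq] using prod_lt (u := u) hc
  have h := infinitePi_inter_preimage_eq_mul (fun _ : ℕ => (expMeasure 1).prod u) hf hD hDF
    (fun i S hS => by
      rcases Nat.eq_zero_or_pos i with rfl | hi
      · rw [hD0, prod_memoryless hc hS, hμ0]
      · simp [D, f, hi.ne']) hB
  rw [infinitePi_univ_pi _ hD hDF, Finset.prod_singleton, hμ0] at h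
  rw [law, ← h]
  congr 1
  ext e
  have : restart c 0 e = fun i => f i (e i) := by
    funext i; simp only [restart, f]; split_ifs with hi <;> simp [hi, time_zero]
  simp only [mem_ofPred_eq, mem_inter_iff, mem_preimage, mem_univ_pi, this]
  refine and_congr ⟨fun h i => ?_, fun h => by simpa [D] using h 0⟩ Iff.rfl
  simp only [D]; split_ifs with hi
  · subst hi; exact h
  · trivial

theorem law_tail (k : ℕ) :
    (law u).map (fun (e : Clock) (i : Fin k) => e i) = Measure.pi (fun _ => (expMeasure 1).prod u)
      ∧ (law u).map (fun (e : Clock) (i : ℕ) => e (k + i)) = law u := by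
  constructor
  · rw [← Measure.infinitePi_eq_pi]
    exact Measure.map_infinitePi_infinitePi_of_inj (P := fun _ : ℕ => (expMeasure 1).prod u)
      Fin.val_injective
  · exact Measure.map_infinitePi_infinitePi_of_inj (P := fun _ : ℕ => (expMeasure 1).prod u)
      (add_right_injective k)

/-- On the event of exactly `k` rings by time `a`, the clock seen from time `a` is a fresh clock,
independent of the first `k` rings. -/
theorem law_restart (a : ℝ) (k : ℕ) {C : Set (Fin k → ℝ × ℤˣ)} (hC : MeasurableSet C)
    {B : Set Clock} (hB : MeasurableSet B) :
    law u {e | (fun i : Fin k => e i) ∈ C ∧ (e.time k ≤ a ∧ a < e.time (k + 1)) ∧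
        restart a k e ∈ B} =
      law u {e | (fun i : Fin k => e i) ∈ C ∧ (e.time k ≤ a ∧ a < e.time (k + 1))} * law u B := by
  set π : Measure (Fin k → ℝ × ℤˣ) := Measure.pi (fun _ => (expMeasure 1).prod u)
  -- The first `k` rings are independent of the remaining ones, which again form a fresh clock.
  have hprod : (law u).map (fun e : Clock => ((fun i : Fin k => e i), fun i : ℕ => e (k + i))) =
      π.prod (law u) := by
    have h := indepFun_of_disjoint_range (P := law u) (X := fun (i : ℕ) (e : Clock) => e i)
      (by fun_prop) iIndepFun_eval (f := fun i : Fin k => (i : ℕ)) (g := fun i : ℕ => k + i)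
      (fun i j => by have := i.2; omega)
    rw [h.map_prod_eq_prod_map_map
      (Measurable.aemeasurable (measurable_pi_lambda _ fun i => measurable_pi_apply _))
      (Measurable.aemeasurable (measurable_pi_lambda _ fun i => measurable_pi_apply _)), (law_tail k).1, (law_tail k).2]
  let r : (Fin k → ℝ × ℤˣ) → ℝ := fun p => ∑ i, (p i).1
  have hr : Measurable r := by fun_prop
  have hrt : ∀ e : Clock, r (fun i : Fin k => e i) = e.time k := fun e => by
    simp only [r, time]; exact Fin.sum_univ_eq_sum_range (fun i => (e i).1) k
  -- Here `a - r q.1` is the part of the current waiting time that has elapsed by time `a`.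
  let S : Set Clock → Set ((Fin k → ℝ × ℤˣ) × Clock) := fun B =>
    {q | q.1 ∈ C ∧ r q.1 ≤ a ∧ a - r q.1 < (q.2 0).1 ∧
      (fun i => if i = 0 then ((q.2 0).1 - (a - r q.1), (q.2 0).2) else q.2 i) ∈ B}
  have hSm : ∀ B, MeasurableSet B → MeasurableSet (S B) := fun B hB => by
    have hr1 : Measurable fun q : (Fin k → ℝ × ℤˣ) × Clock => r q.1 := hr.comp measurable_fst
    have h2 : Measurable fun q : (Fin k → ℝ × ℤˣ) × Clock => (q.2 0).1 := by fun_prop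
    refine (measurable_fst hC).inter ((measurableSet_le hr1 measurable_const).inter
      ((measurableSet_lt (hr1.const_sub a) h2).inter (hB.preimage ?_)))
    refine measurable_pi_lambda _ fun i => ?_
    split_ifs <;> fun_prop
  have hS : ∀ B, MeasurableSet B → law u {e | (fun i : Fin k => e i) ∈ C ∧
      (e.time k ≤ a ∧ a < e.time (k + 1)) ∧ restart a k e ∈ B} = (∫⁻ p, (C ∩ {p | r p ≤ a}).indicator
        (fun p => ENNReal.ofReal (Real.exp (-(a - r p)))) p ∂π) * law u B := fun B hB => by
    have h1 : {e | (fun i : Fin k => e i) ∈ C ∧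
      (e.time k ≤ a ∧ a < e.time (k + 1)) ∧ restart a k e ∈ B} =
        (fun e : Clock => ((fun i : Fin k => e i), fun i : ℕ => e (k + i))) ⁻¹' S B := by
      ext e
      simp only [mem_ofPred_eq, mem_preimage, S, hrt, time_succ, add_zero, sub_lt_iff_lt_add',
        and_assoc]
      rfl
    rw [h1, ← Measure.map_apply (by fun_prop) (hSm B hB), hprod, Measure.prod_apply (hSm B hB),
      ← lintegral_mul_const]
    · refine lintegral_congr fun p => ?_
      by_cases hp : p ∈ C ∩ {p | r p ≤ a}
      · rw [indicator_of_mem hp, ← law_memoryless (sub_nonneg.2 hp.2) hB]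
        congr 1
        ext e
        have hp1 := hp.1
        have hp2 : r p ≤ a := hp.2
        have h3 : restart (a - r p) 0 e =
            fun i => if i = 0 then ((e 0).1 - (a - r p), (e 0).2) else e i := by
          funext i; simp [restart, time_zero]
        simp only [mem_preimage, mem_ofPred_eq, S, hp1, hp2, true_and, h3]
      · rw [indicator_of_notMem hp, zero_mul]
        convert measure_empty (μ := law u)
        ext e
        simp only [mem_preimage, S, mem_ofPred_eq, mem_empty_iff_false, iff_false]
        exact fun h => hp ⟨h.1, h.2.1⟩
    · exact Measurable.indicator (by fun_prop)
        (hC.inter (measurableSet_le hr measurable_const))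
  -- Taking `B = univ` identifies the integral as the probability of the conditioning event.
  have hu := hS univ MeasurableSet.univ
  simp only [mem_univ, and_true, measure_univ, mul_one] at hu
  rw [hS B hB, hu]

/-- By the second Borel–Cantelli lemma infinitely many waiting times exceed `1`, so the ring times
are unbounded. -/
theorem ae_good : ∀ᵐ e ∂law u, Good e := by
  have h1 : ∀ᵐ e ∂law u, ∀ i, 0 < (e i).1 := by
    rw [ae_all_iff]
    intro i
    have hS : MeasurableSet {p : ℝ × ℤˣ | 0 < p.1} :=
      measurableSet_lt measurable_const measurable_fst
    have := law_eval (u := u) i hS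
    rw [prod_lt le_rfl, neg_zero, Real.exp_zero, ENNReal.ofReal_one] at this
    exact (prob_compl_eq_zero_iff ((measurable_pi_apply i) hS)).2 this
  have h2 : ∀ᵐ e ∂law u, ∃ᶠ i in Filter.atTop, 1 < (e i).1 := by
    have hS : MeasurableSet {p : ℝ × ℤˣ | 1 < p.1} :=
      measurableSet_lt measurable_const measurable_fst
    have hm : ∀ i : ℕ, MeasurableSet {e : Clock | 1 < (e i).1} := fun i =>
      measurableSet_lt measurable_const (by fun_prop)
    have hl : law u (Filter.limsup (fun i : ℕ => {e : Clock | 1 < (e i).1}) Filter.atTop) = 1 := by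
      refine measure_limsup_eq_one hm ?_ ?_
      · rw [iIndepSet_iff_meas_biInter hm]
        intro s
        exact (iIndepFun_eval (u := u)).measure_inter_preimage_eq_mul s
          (sets := fun _ => {p | 1 < p.1}) fun i _ => hS
      · have : ∀ i : ℕ, law u {e : Clock | 1 < (e i).1} = ENNReal.ofReal (Real.exp (-1)) := by
          intro i
          rw [← prod_lt (u := u) zero_le_one]
          exact law_eval (u := u) i hS
        simp_rw [this]
        exact ENNReal.tsum_const_eq_top_of_ne_zero (by simp [Real.exp_pos])
    have hmem : ∀ᵐ e ∂law u, e ∈ Filter.limsup (fun i : ℕ => {e : Clock | 1 < (e i).1}) Filter.atTop :=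
      (prob_compl_eq_zero_iff (MeasurableSet.measurableSet_limsup hm)).2 hl
    filter_upwards [hmem] with e he
    simpa [Filter.mem_limsup_iff_frequently_mem] using he
  filter_upwards [h1, h2] with e he1 he2
  refine ⟨he1, fun a => ?_⟩
  have hmono : Monotone e.time := monotone_nat_of_le_succ fun k => by
    rw [time_succ]; linarith [he1 k]
  have : ∀ n : ℕ, ∃ k, (n : ℝ) ≤ e.time k := by
    intro n
    induction n with
    | zero => exact ⟨0, by simp [time_zero]⟩
    | succ n ih =>
      obtain ⟨k, hk⟩ := ih
      obtain ⟨i, hi, hi1⟩ := Filter.frequently_atTop.1 he2 k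
      refine ⟨i + 1, ?_⟩
      rw [time_succ]; push_cast
      linarith [hmono hi]
  obtain ⟨n, hn⟩ := exists_nat_gt a
  obtain ⟨k, hk⟩ := this n
  exact ⟨k, hn.trans_le hk⟩

/-- Once `n` rings have occurred, the clock seen from time `a` is a fresh clock, independent of the
first `n` rings. -/
theorem law_inter_shift {a : ℝ} (ha : 0 ≤ a) (n : ℕ) {C : Set (Fin n → ℝ × ℤˣ)}
    (hC : MeasurableSet C) {B : Set Clock} (hB : MeasurableSet B) :
    law u ({e | (fun i : Fin n => e i) ∈ C ∧ e.time n ≤ a} ∩ shift a ⁻¹' B) =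
      law u {e | (fun i : Fin n => e i) ∈ C ∧ e.time n ≤ a} * law u B := by
  -- Split by the exact number `k` of rings up to `a`; only `k ≥ n` contributes, and each piece is
  -- handled by `law_restart`.
  let Q : ℕ → Set Clock := fun k => {e | (fun i : Fin n => e i) ∈ C ∧ n ≤ k ∧ count a e = k}
  have hQm : ∀ k, MeasurableSet (Q k) := fun k => by
    refine MeasurableSet.inter (hC.preimage (by fun_prop)) (MeasurableSet.inter ?_ ?_)
    · exact MeasurableSet.const _
    · exact (measurable_count a) (measurableSet_singleton k)
  have hdisj : Pairwise (Function.onFun Disjoint Q) := fun k l hkl => by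
    rw [Function.onFun, Set.disjoint_left]
    rintro e ⟨-, -, h1⟩ ⟨-, -, h2⟩
    exact hkl (h1.symm.trans h2)
  have hkey : ∀ k B, MeasurableSet B → law u (Q k ∩ shift a ⁻¹' B) = law u (Q k) * law u B := by
    intro k B hB
    by_cases hk : n ≤ k
    · have hC' : MeasurableSet {p : Fin k → ℝ × ℤˣ | (fun i : Fin n => p (Fin.castLE hk i)) ∈ C} :=
        hC.preimage (by fun_prop)
      have h := law_restart (u := u) a k hC' hB
      convert h using 1
      · refine measure_congr ?_
        filter_upwards [ae_good (u := u)] with e he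
        apply propext
        change ((_ ∧ n ≤ k ∧ count a e = k) ∧ shift a e ∈ B) ↔
          (_ ∧ (e.time k ≤ a ∧ a < e.time (k + 1)) ∧ restart a k e ∈ B)
        rw [← he.count_eq_iff ha]
        constructor
        · rintro ⟨⟨h1, h2, h3⟩, h4⟩
          exact ⟨h1, h3, by rw [← h3]; exact h4⟩
        · rintro ⟨h1, h3, h4⟩
          exact ⟨⟨h1, hk, h3⟩, by rw [shift, h3]; exact h4⟩
      · congr 1
        refine measure_congr ?_
        filter_upwards [ae_good (u := u)] with e he
        apply propext
        change (_ ∧ n ≤ k ∧ count a e = k) ↔ (_ ∧ (e.time k ≤ a ∧ a < e.time (k + 1)))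
        rw [← he.count_eq_iff ha]
        exact and_congr Iff.rfl ⟨fun h => h.2, fun h => ⟨hk, h⟩⟩
    · have : Q k = ∅ := by ext e; simp [Q, hk]
      simp [this]
  have hE : ({e | (fun i : Fin n => e i) ∈ C ∧ e.time n ≤ a} : Set Clock) =ᵐ[law u] ⋃ k, Q k := by
    filter_upwards [ae_good (u := u)] with e he
    apply propext
    change (_ ∧ e.time n ≤ a) ↔ e ∈ ⋃ k, Q k
    obtain ⟨h1, h2⟩ := he.count_spec ha
    simp only [mem_iUnion, Q, mem_ofPred_eq]
    constructor
    · rintro ⟨h3, h4⟩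
      have : n < count a e + 1 := he.strictMono.lt_iff_lt.1 (by linarith)
      exact ⟨_, h3, by omega, rfl⟩
    · rintro ⟨k, h3, h4, h5⟩
      subst h5
      exact ⟨h3, (he.strictMono.monotone h4).trans h1⟩
  rw [measure_congr hE, measure_congr (hE.inter (Filter.EventuallyEq.refl _ (shift a ⁻¹' B))),
    iUnion_inter, measure_iUnion (fun k l hkl => (hdisj hkl).mono inter_subset_left inter_subset_left)
      (fun k => (hQm k).inter (measurable_shift a hB)), measure_iUnion hdisj hQm,
    ← ENNReal.tsum_mul_right]
  exact tsum_congr fun k => hkey k B hB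

theorem law_shift {a : ℝ} (ha : 0 ≤ a) {B : Set Clock} (hB : MeasurableSet B) :
    law u (shift a ⁻¹' B) = law u B := by
  have h := law_inter_shift (u := u) ha 0 (C := univ) MeasurableSet.univ hB
  simpa [time_zero, ha] using h

end Clock

/-! ### All sites together: stationarity and the zero-one law. -/

/-- The clocks at all sites. -/
abbrev Clocks : Type := Site → Clock

namespace Clocks

/-- The joint law of all clocks. -/
noncomputable def law (u : Measure ℤˣ) : Measure Clocks :=
  Measure.infinitePi fun _ : Site => Clock.law u

/-- All clocks seen from time `a`. -/
noncomputable def shift (a : ℝ) (x : Clocks) : Clocks := fun z => (x z).shift a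

/-- The arrows in force at time `a`. -/
noncomputable def arrows (x : Clocks) (a : ℝ) : Config := fun z => (x z).mark a

variable {u : Measure ℤˣ} [IsProbabilityMeasure u]

instance : IsProbabilityMeasure (law u) := by unfold law; infer_instance

theorem ae_good : ∀ᵐ x ∂law u, ∀ z, (x z).Good := by
  rw [ae_all_iff]
  intro z
  exact (measurePreserving_eval_infinitePi (fun _ : Site => Clock.law u) z).quasiMeasurePreserving.ae
    Clock.ae_good

theorem measurable_shift (a : ℝ) : Measurable (shift a) := by
  unfold shift; fun_prop

theorem measurePreserving_shift {a : ℝ} (ha : 0 ≤ a) :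
    MeasurePreserving (shift a) (law u) (law u) := by
  refine ⟨measurable_shift a, ?_⟩
  have h : (Clock.law u).map (Clock.shift a) = Clock.law u := by
    ext B hB
    rw [Measure.map_apply (by fun_prop) hB, Clock.law_shift ha hB]
  have h2 := Measure.infinitePi_map_pi (fun _ : Site => Clock.law u)
    (f := fun _ => Clock.shift a) (fun _ => by fun_prop)
  simp_rw [h] at h2
  exact h2

/-- An event that is invariant under the time shift is trivial. -/
theorem measure_eq_zero_or_one {B : Set Clocks} (hB : MeasurableSet B)
    (hinv : ∀ a : ℕ, shift a ⁻¹' B =ᵐ[law u] B) : law u B = 0 ∨ law u B = 1 := by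
  classical
  rw [or_iff_not_imp_left]
  intro h0
  have hT : law u B ≠ ∞ := measure_ne_top _ _
  have hlaw : (law u).map (MeasurableEquiv.curry Site ℕ (ℝ × ℤˣ)).symm =
      Measure.infinitePi fun _ : Site × ℕ => (expMeasure 1).prod u :=
    Measure.infinitePi_map_curry_symm (fun (_ : Site) (_ : ℕ) => (expMeasure 1).prod u)
  -- It suffices that conditioning on `B` leaves the law unchanged: `B` has conditional probability
  -- `1`. This is checked on finite-dimensional boxes.
  suffices h : (law u B)⁻¹ • (law u).restrict B = law u by
    have h1 := congrArg (fun ν => ν B) h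
    simp only [Measure.smul_apply, smul_eq_mul, Measure.restrict_apply hB, inter_self] at h1
    rw [← h1, ENNReal.inv_mul_cancel h0 hT]
  apply (MeasurableEquiv.curry Site ℕ (ℝ × ℤˣ)).symm.map_measurableEquiv_injective
  rw [hlaw]
  refine eq_infinitePi_of_boxes _ ∅ fun s _ t ht hts => ?_
  have hm := measurableSet_univ_pi_of_univ ht hts
  set Q : Set Clocks := (MeasurableEquiv.curry Site ℕ (ℝ × ℤˣ)).symm ⁻¹' (Set.pi univ t) with hQ
  have hQm : MeasurableSet Q := MeasurableEquiv.measurable _ hm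
  have hQt : ∀ x, x ∈ Q ↔ ∀ z i, x z i ∈ t (z, i) := fun x => by
    simp only [hQ, mem_preimage, Set.mem_pi, Prod.forall, mem_univ, true_implies]; rfl
  rw [MeasurableEquiv.map_apply, ← hQ, Measure.smul_apply, Measure.restrict_apply hQm, smul_eq_mul,
    ← infinitePi_univ_pi _ ht hts, ← hlaw, MeasurableEquiv.map_apply, ← hQ]
  let F : Finset Site := s.image Prod.fst
  obtain ⟨n, hn⟩ : ∃ n, ∀ p ∈ s, p.2 < n :=
    ⟨s.sup Prod.snd + 1, fun p hp => Nat.lt_succ_of_le (Finset.le_sup (f := Prod.snd) hp)⟩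
  let C : Site → Set (Fin n → ℝ × ℤˣ) := fun z => Set.pi univ fun i => t (z, i)
  have hC : ∀ z, MeasurableSet (C z) := fun z => MeasurableSet.univ_pi fun i => ht _
  -- The box condition together with the requirement that the rings involved are over by time `a`.
  -- By the renewal property such an event is independent of the clocks seen from `a`, hence of `B`.
  let D : ℕ → Site → Set Clock := fun a z =>
    if z ∈ F then {e | (fun i : Fin n => e i) ∈ C z ∧ e.time n ≤ a} else univ
  have hDm : ∀ a z, MeasurableSet (D a z) := fun a z => by
    simp only [D]; split_ifs
    · exact ((hC z).preimage (by fun_prop)).inter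
        (measurableSet_le (Clock.measurable_time n) measurable_const)
    · exact MeasurableSet.univ
  have hDF : ∀ a, ∀ z ∉ F, D a z = univ := fun a z hz => by simp [D, hz]
  have hmix : ∀ a : ℕ, law u (Set.pi univ (D a) ∩ B) = law u (Set.pi univ (D a)) * law u B := by
    intro a
    rw [← measure_congr ((Filter.EventuallyEq.refl _ (Set.pi univ (D a))).inter (hinv a))]
    refine infinitePi_inter_preimage_eq_mul (fun _ : Site => Clock.law u)
      (fun _ => Clock.measurable_shift a) (hDm a) (hDF a) (fun z S hS => ?_) hB
    simp only [D]; split_ifs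
    · exact Clock.law_inter_shift a.cast_nonneg n (hC z) hS
    · simp [Clock.law_shift a.cast_nonneg hS]
  have hmono : Monotone fun a : ℕ => Set.pi univ (D a) := fun a b hab => by
    refine Set.pi_mono fun z _ e he => ?_
    simp only [D] at he ⊢
    split_ifs at he ⊢
    · exact ⟨he.1, he.2.trans (Nat.cast_le.2 hab)⟩
    · trivial
  -- Only finitely many sites are involved, so the time requirement disappears as `a → ∞`.
  have hU : ⋃ a : ℕ, Set.pi univ (D a) = Q := by
    ext x
    simp only [mem_iUnion, hQt, mem_univ_pi]
    constructor
    · rintro ⟨a, ha⟩ z i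
      by_cases hp : (z, i) ∈ s
      · have := ha z
        simp only [D, if_pos (show z ∈ F from Finset.mem_image.2 ⟨_, hp, rfl⟩)] at this
        exact this.1 ⟨i, hn _ hp⟩ trivial
      · rw [hts _ hp]; trivial
    · intro h
      obtain ⟨b, hb⟩ := (F.image fun z => (x z).time n).exists_le
      obtain ⟨a, ha⟩ := exists_nat_ge b
      refine ⟨a, fun z => ?_⟩
      simp only [D]; split_ifs with hz
      · exact ⟨fun i _ => h z i, (hb _ (Finset.mem_image_of_mem _ hz)).trans ha⟩
      · trivial
  have l1 := tendsto_measure_iUnion_atTop (μ := law u) hmono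
  have l2 := tendsto_measure_iUnion_atTop (μ := law u)
    (s := fun a : ℕ => Set.pi univ (D a) ∩ B) fun a b hab => inter_subset_inter_left _ (hmono hab)
  rw [hU] at l1
  rw [← iUnion_inter, hU] at l2
  have l3 : Filter.Tendsto (fun a : ℕ => law u (Set.pi univ (D a)) * law u B) Filter.atTop
      (nhds (law u Q * law u B)) := ENNReal.Tendsto.mul_const l1 (Or.inr hT)
  have : law u (Q ∩ B) = law u Q * law u B :=
    tendsto_nhds_unique l2 (l3.congr fun a => (hmix a).symm)
  rw [this, mul_comm, mul_assoc, ENNReal.mul_inv_cancel h0 hT, mul_one]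

/-- A bounded functional that can only decrease under the time shift is almost surely constant. -/
theorem exists_ae_eq_const {g : Clocks → ℝ≥0∞} (hg : Measurable g) {b : ℝ≥0∞} (hb : b ≠ ∞)
    (hgb : ∀ x, g x ≤ b) (hdec : ∀ a : ℕ, ∀ᵐ x ∂law u, g (shift a x) ≤ g x) :
    ∃ c, ∀ᵐ x ∂law u, g x = c := by
  -- The two functions are ordered and have the same finite integral, so they agree almost
  -- everywhere.
  have hinv : ∀ a : ℕ, (fun x => g (shift a x)) =ᵐ[law u] g := fun a => by
    have hmp := measurePreserving_shift (u := u) a.cast_nonneg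
    refine ae_eq_of_ae_le_of_lintegral_le (hdec a) ?_ hg.aemeasurable ?_
    · refine ne_top_of_le_ne_top hb ?_
      calc _ ≤ ∫⁻ _, b ∂law u := lintegral_mono fun x => hgb _
        _ = b := by simp
    · rw [hmp.lintegral_comp hg]
  refine Filter.exists_eventuallyEq_const_of_forall_separating MeasurableSet (f := g) fun U hU => ?_
  rcases measure_eq_zero_or_one (u := u) (hg hU) (fun a => by
    filter_upwards [hinv a] with x hx
    apply propext
    change g (shift a x) ∈ U ↔ g x ∈ U
    rw [hx]) with h | h
  · right
    exact measure_eq_zero_iff_ae_notMem.1 h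
  · left
    exact (prob_compl_eq_zero_iff (hg hU)).2 h

end Clocks

/-! ### Measurability of the dimension of random compact sets. -/

section HausdorffDimension

open Filter Topology

/-- Widening the convex hull of `t` slightly costs at most `δ`, by continuity of the `s`-th power.
-/
theorem exists_rat_Ioo_superset {s : ℝ} (hs : 0 < s) {t : Set ℝ} (ht : Metric.ediam t ≠ ∞)
    {δ : ℝ≥0∞} (hδ : δ ≠ 0) :
    ∃ I : ℚ × ℚ, t ⊆ Ioo (I.1 : ℝ) I.2 ∧
      ENNReal.ofReal ((I.2 : ℝ) - I.1) ^ s ≤ (⨆ _ : t.Nonempty, Metric.ediam t ^ s) + δ := by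
  rcases t.eq_empty_or_nonempty with rfl | hne
  · exact ⟨(0, 0), by simp, by simp [hs]⟩
  have hb : Bornology.IsBounded t := Metric.isBounded_iff_ediam_ne_top.2 ht
  have hlt : Metric.ediam t ^ s < Metric.ediam t ^ s + δ :=
    ENNReal.lt_add_right (ENNReal.rpow_ne_top_of_nonneg hs.le ht) hδ
  rw [iSup_pos hne, Real.ediam_eq hb] at *
  have hcont : Continuous fun h : ℝ => ENNReal.ofReal ((sSup t + h) - (sInf t - h)) ^ s :=
    (ENNReal.continuous_rpow_const).comp (ENNReal.continuous_ofReal.comp (by fun_prop))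
  have hev : ∀ᶠ h in 𝓝 (0 : ℝ), ENNReal.ofReal ((sSup t + h) - (sInf t - h)) ^ s <
      ENNReal.ofReal (sSup t - sInf t) ^ s + δ :=
    hcont.continuousAt.eventually_lt continuousAt_const (by simpa using hlt)
  obtain ⟨h, hh, h0⟩ := ((hev.filter_mono nhdsWithin_le_nhds).and
    (self_mem_nhdsWithin (s := Ioi (0 : ℝ)))).exists
  have h0 : 0 < h := h0
  obtain ⟨a, ha1, ha2⟩ := exists_rat_btwn (show sInf t - h < sInf t by linarith)
  obtain ⟨b, hb1, hb2⟩ := exists_rat_btwn (show sSup t < sSup t + h by linarith)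
  refine ⟨(a, b), fun x hx => ⟨ha2.trans_le (csInf_le hb.bddBelow hx),
    (le_csSup hb.bddAbove hx).trans_lt hb1⟩, ?_⟩
  refine le_trans ?_ hh.le
  exact ENNReal.rpow_le_rpow (ENNReal.ofReal_le_ofReal (by dsimp only; linarith)) hs.le

/-- For compact sets of reals, vanishing of a Hausdorff measure can be tested by finite covers by
open intervals with rational endpoints. -/
theorem hausdorffMeasure_eq_zero_iff_rat_cover {s : ℝ} (hs : 0 < s) {K : Set ℝ} (hK : IsCompact K) :
    μH[s] K = 0 ↔ ∀ n : ℕ, ∃ F : Finset (ℚ × ℚ),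
      ∑ I ∈ F, ENNReal.ofReal ((I.2 : ℝ) - I.1) ^ s ≤ ((n : ℝ≥0∞) + 1)⁻¹ ∧
      K ⊆ ⋃ I ∈ F, Ioo (I.1 : ℝ) I.2 := by
  classical
  constructor
  · intro h n
    set ε : ℝ≥0∞ := ((n : ℝ≥0∞) + 1)⁻¹ with hε
    have hε0 : ε ≠ 0 := by simp [hε]
    have h1 := Measure.hausdorffMeasure_apply s K
    rw [h] at h1
    -- The Hausdorff measure is a supremum over mesh sizes; mesh size `1` alone already gives value
    -- zero.
    have h2 : (⨅ (t : ℕ → Set ℝ) (_ : K ⊆ ⋃ n, t n) (_ : ∀ n, Metric.ediam (t n) ≤ 1),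
          ∑' n, ⨆ _ : (t n).Nonempty, Metric.ediam (t n) ^ s) = 0 := by
      apply le_antisymm _ zero_le
      rw [h1]
      exact le_iSup₂_of_le (1 : ℝ≥0∞) one_pos le_rfl
    have h3 : (⨅ (t : ℕ → Set ℝ) (_ : K ⊆ ⋃ n, t n) (_ : ∀ n, Metric.ediam (t n) ≤ 1),
          ∑' n, ⨆ _ : (t n).Nonempty, Metric.ediam (t n) ^ s) < ε / 2 := by
      rw [h2]; exact ENNReal.half_pos hε0
    simp only [iInf_lt_iff] at h3
    obtain ⟨t, hKt, htd, ht⟩ := h3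
    obtain ⟨δ, hδ0, hδ⟩ := ENNReal.exists_pos_sum_of_countable' (ENNReal.half_pos hε0).ne' ℕ
    choose I hI1 hI2 using fun n => exists_rat_Ioo_superset hs
      (ne_top_of_le_ne_top ENNReal.one_ne_top (htd n)) (hδ0 n).ne'
    obtain ⟨T, hT⟩ := hK.elim_finite_subcover (fun n => Ioo ((I n).1 : ℝ) (I n).2)
      (fun n => isOpen_Ioo) (hKt.trans (iUnion_mono hI1))
    refine ⟨T.image I, ?_, fun x hx => ?_⟩
    · calc ∑ J ∈ T.image I, ENNReal.ofReal ((J.2 : ℝ) - J.1) ^ s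
          ≤ ∑ n ∈ T, ENNReal.ofReal (((I n).2 : ℝ) - (I n).1) ^ s :=
            Finset.sum_image_le_of_nonneg (fun _ _ => zero_le)
        _ ≤ ∑' n, ENNReal.ofReal (((I n).2 : ℝ) - (I n).1) ^ s := ENNReal.sum_le_tsum _
        _ ≤ ∑' n, ((⨆ _ : (t n).Nonempty, Metric.ediam (t n) ^ s) + δ n) :=
            ENNReal.tsum_le_tsum hI2
        _ ≤ ε / 2 + ε / 2 := by rw [ENNReal.tsum_add]; exact add_le_add ht.le hδ.le
        _ = ε := ENNReal.add_halves ε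
    · obtain ⟨n, hn, hx⟩ := mem_iUnion₂.1 (hT hx)
      exact mem_iUnion₂.2 ⟨I n, Finset.mem_image_of_mem _ hn, hx⟩
  · intro h
    choose F hF1 hF2 using h
    have hlim : Tendsto (fun n : ℕ => ((n : ℝ≥0∞) + 1)⁻¹) atTop (𝓝 0) := by
      have := (tendsto_add_atTop_iff_nat 1).2 ENNReal.tendsto_inv_nat_nhds_zero
      simpa using this
    -- No mesh bound is imposed on the covers. It is automatic: a single term is at most the whole
    -- sum, so each length is at most `(n + 1)⁻¹` to the power `s⁻¹`.
    have hr : Tendsto (fun n : ℕ => (((n : ℝ≥0∞) + 1)⁻¹) ^ (s⁻¹)) atTop (𝓝 0) := by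
      have := (ENNReal.continuous_rpow_const (y := s⁻¹)).tendsto 0 |>.comp hlim
      rwa [ENNReal.zero_rpow_of_pos (inv_pos.2 hs)] at this
    have hd : ∀ n (I : F n), Metric.ediam (Ioo (I.1.1 : ℝ) I.1.2) ^ s ≤
        ENNReal.ofReal ((I.1.2 : ℝ) - I.1.1) ^ s := fun n I => by rw [Real.ediam_Ioo]
    have h1 := Measure.hausdorffMeasure_le_liminf_tsum s K _ hr
      (fun n (I : F n) => Ioo (I.1.1 : ℝ) I.1.2) (Eventually.of_forall fun n I => ?_)
      (Eventually.of_forall fun n => (hF2 n).trans (by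
        intro x hx
        obtain ⟨J, hJ, hx⟩ := mem_iUnion₂.1 hx
        exact mem_iUnion.2 ⟨⟨J, hJ⟩, hx⟩))
    · refine le_antisymm (h1.trans ?_) zero_le
      rw [← hlim.liminf_eq]
      refine liminf_le_liminf (Eventually.of_forall fun n => ?_)
      refine le_trans (ENNReal.tsum_le_tsum (hd n)) ?_
      rw [tsum_fintype, Finset.univ_eq_attach,
        Finset.sum_attach (F n) fun I => ENNReal.ofReal ((I.2 : ℝ) - I.1) ^ s]
      exact hF1 n
    · rw [← ENNReal.rpow_le_rpow_iff hs, ← ENNReal.rpow_mul, inv_mul_cancel₀ hs.ne',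
        ENNReal.rpow_one]
      refine (hd n I).trans (le_trans ?_ (hF1 n))
      exact Finset.single_le_sum (f := fun I : ℚ × ℚ => ENNReal.ofReal ((I.2 : ℝ) - I.1) ^ s)
        (fun _ _ => zero_le) I.2

/-- The Hausdorff dimension of a measurable family of compact sets of reals is measurable. -/
theorem measurable_dimH_of_isCompact {Ω : Type*} [MeasurableSpace Ω] {K : Ω → Set ℝ}
    (hK : ∀ ω, IsCompact (K ω)) (h : ∀ U, IsOpen U → MeasurableSet {ω | K ω ⊆ U}) :
    Measurable fun ω => dimH (K ω) := by
  have hz : ∀ s : ℝ, 0 < s → MeasurableSet {ω | μH[s] (K ω) = 0} := fun s hs => by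
    simp_rw [hausdorffMeasure_eq_zero_iff_rat_cover hs (hK _), ofPred_forall, ofPred_exists]
    refine MeasurableSet.iInter fun n => MeasurableSet.iUnion fun F => ?_
    exact (MeasurableSet.const _).inter
      (h _ (isOpen_biUnion fun I _ => isOpen_Ioo))
  refine measurable_of_Iio fun c => ?_
  have : (fun ω => dimH (K ω)) ⁻¹' Iio c =
      ⋃ q : {q : ℚ // 0 < q ∧ ((Real.toNNReal q : NNReal) : ℝ≥0∞) < c},
        {ω | μH[(q.1 : ℝ)] (K ω) = 0} := by
    ext ω
    simp only [mem_preimage, mem_Iio, mem_iUnion, mem_ofPred_eq, Subtype.exists, exists_prop]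
    constructor
    · intro hlt
      obtain ⟨q, hq0, hq1, hq2⟩ := ENNReal.lt_iff_exists_rat_btwn.1 hlt
      have hq : (0 : ℝ) < q := by
        have : (0 : ℝ≥0∞) < ((Real.toNNReal q : NNReal) : ℝ≥0∞) := lt_of_le_of_lt zero_le hq1
        simpa using this
      refine ⟨q, ⟨by exact_mod_cast hq, hq2⟩, ?_⟩
      have := hausdorffMeasure_of_dimH_lt hq1
      rwa [Real.coe_toNNReal _ hq.le] at this
    · rintro ⟨q, ⟨hq0, hq2⟩, hq⟩
      refine lt_of_le_of_lt (dimH_le_of_hausdorffMeasure_ne_top ?_) hq2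
      rw [Real.coe_toNNReal _ (by exact_mod_cast hq0.le), hq]
      exact ENNReal.zero_ne_top
  rw [this]
  exact MeasurableSet.iUnion fun q => hz _ (by exact_mod_cast q.2.1)

end HausdorffDimension

/-! ### Almost sure constancy of the dimension of a set of times. -/

section Arrows

open Filter Topology

namespace Clock

theorem Good.eventually_mark_eq_right {e : Clock} (h : e.Good) {a : ℝ} (ha : 0 ≤ a) :
    ∀ᶠ b in 𝓝[>] a, e.mark b = e.mark a := by
  obtain ⟨h1, h2⟩ := h.count_spec ha
  filter_upwards [Ioo_mem_nhdsGT h2] with b hb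
  have : count b e = count a e :=
    (h.count_eq_iff (ha.trans hb.1.le)).2 ⟨h1.trans hb.1.le, hb.2⟩
  rw [mark, mark, this]

theorem Good.eventually_mark_eq {e : Clock} (h : e.Good) {a : ℝ} (ha : 0 ≤ a)
    (hne : ∀ k, e.time k ≠ a) : ∀ᶠ b in 𝓝 a, e.mark b = e.mark a := by
  obtain ⟨h1, h2⟩ := h.count_spec ha
  have h0 : 0 ≤ e.time (count a e) := by
    rw [← time_zero e]; exact h.strictMono.monotone (Nat.zero_le _)
  filter_upwards [Ioo_mem_nhds (lt_of_le_of_ne h1 (hne _)) h2] with b hb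
  have : count b e = count a e := (h.count_eq_iff (h0.trans hb.1.le)).2 ⟨hb.1.le, hb.2⟩
  rw [mark, mark, this]

end Clock

instance : MeasurableSingletonClass ℤˣ where
  measurableSet_singleton v := ⟨{(v : ℤ)}, measurableSet_singleton _, by ext w; simp [Units.ext_iff]⟩

/-- A set of arrow configurations that is determined by the arrows at finitely many sites. -/
def IsLocal (A : Set Config) : Prop :=
  ∃ F : Finset Site, ∀ ξ η : Config, (∀ z ∈ F, ξ z = η z) → ξ ∈ A → η ∈ A

theorem IsLocal.measurableSet {A : Set Config} (hA : IsLocal A) : MeasurableSet A := by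
  obtain ⟨F, hF⟩ := hA
  have : A = (F.restrict : Config → (F → ℤˣ)) ⁻¹' (F.restrict '' A) := by
    refine Subset.antisymm (subset_preimage_image _ _) ?_
    rintro ξ ⟨η, hη, h⟩
    exact hF η ξ (fun z hz => congrFun h ⟨z, hz⟩) hη
  rw [this]
  exact (Set.toFinite _).measurableSet.preimage (Finset.measurable_restrict F)

namespace Clocks

/-- The nonnegative times at which the arrow configuration lies in `A`. -/
def times (A : Set Config) (x : Clocks) : Set ℝ := {τ | 0 ≤ τ ∧ x.arrows τ ∈ A}

theorem measurable_arrows (τ : ℝ) : Measurable fun x : Clocks => x.arrows τ := by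
  unfold arrows; fun_prop

theorem arrows_shift {x : Clocks} (hx : ∀ z, (x z).Good) {a τ : ℝ} (ha : 0 ≤ a) (hτ : 0 ≤ τ) :
    (x.shift a).arrows τ = x.arrows (a + τ) :=
  funext fun z => (hx z).mark_shift ha hτ

/-- Translating by `a` embeds the times of the shifted clocks isometrically into those of the
original ones. -/
theorem dimH_times_shift_le {x : Clocks} (hx : ∀ z, (x z).Good) {a : ℝ} (ha : 0 ≤ a)
    (A : Set Config) : dimH (times A (x.shift a)) ≤ dimH (times A x) := by
  rw [← (isometry_add_left a).dimH_image]
  refine dimH_mono ?_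
  rintro _ ⟨τ, ⟨h0, hτ⟩, rfl⟩
  exact ⟨add_nonneg ha h0, by rwa [← arrows_shift hx ha h0]⟩

/-- The rational times at which the arrow configuration lies in `A`. -/
def ratTimes (A : Set Config) (x : Clocks) : Set ℝ := {τ | τ ∈ times A x ∧ ∃ q : ℚ, (q : ℝ) = τ}

/-- A compact approximation of the times in `[0, M]` at which the configuration lies in all `A n`;
it differs from that set only by ring times. -/
def compactTimes (A : ℕ → Set Config) (M : ℕ) (x : Clocks) : Set ℝ :=
  Icc 0 (M : ℝ) ∩ ⋂ n, closure (ratTimes (A n) x)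

variable {A : ℕ → Set Config}

theorem isCompact_compactTimes (M : ℕ) (x : Clocks) : IsCompact (compactTimes A M x) :=
  isCompact_Icc.inter_right (isClosed_iInter fun _ => isClosed_closure)

/-- Arrows are right-continuous in dynamical time and `A n` depends on finitely many of them, so
every such time is a limit from the right of rational ones. -/
theorem times_inter_Icc_subset (hA : ∀ n, IsLocal (A n)) (M : ℕ) {x : Clocks}
    (hx : ∀ z, (x z).Good) : times (⋂ n, A n) x ∩ Icc 0 (M : ℝ) ⊆ compactTimes A M x := by
  rintro τ ⟨⟨h0, hτ⟩, hM⟩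
  refine ⟨hM, mem_iInter.2 fun n => ?_⟩
  obtain ⟨F, hF⟩ := hA n
  have hev : ∀ᶠ b in 𝓝[>] τ, b ∈ times (A n) x := by
    have h1 : ∀ᶠ b in 𝓝[>] τ, ∀ z ∈ F, (x z).mark b = (x z).mark τ :=
      (Finset.eventually_all F).2 fun z _ => (hx z).eventually_mark_eq_right h0
    filter_upwards [h1, self_mem_nhdsWithin] with b hb hb0
    exact ⟨h0.trans (le_of_lt hb0), hF _ _ (fun z hz => (hb z hz).symm) (mem_iInter.1 hτ n)⟩
  obtain ⟨c, hc, hsub⟩ := mem_nhdsGT_iff_exists_Ioo_subset.1 hev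
  rw [Metric.mem_closure_iff]
  intro ε hε
  obtain ⟨q, hq1, hq2⟩ := exists_rat_btwn (lt_min (show τ < c from hc) (show τ < τ + ε by linarith))
  refine ⟨q, ⟨hsub ⟨hq1, hq2.trans_le (min_le_left _ _)⟩, q, rfl⟩, ?_⟩
  rw [Real.dist_eq, abs_sub_lt_iff]
  have := hq2.trans_le (min_le_right _ _)
  constructor <;> linarith

/-- Away from ring times the finitely many arrows that decide `A n` are constant near `τ`, so a
nearby rational time decides membership at `τ`. -/
theorem compactTimes_subset (hA : ∀ n, IsLocal (A n)) (M : ℕ) {x : Clocks}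
    (hx : ∀ z, (x z).Good) : compactTimes A M x ⊆
      (times (⋂ n, A n) x ∩ Icc 0 (M : ℝ)) ∪ range fun p : Site × ℕ => (x p.1).time p.2 := by
  rintro τ ⟨hM, hτ⟩
  by_cases hr : τ ∈ range fun p : Site × ℕ => (x p.1).time p.2
  · exact Or.inr hr
  refine Or.inl ⟨⟨hM.1, mem_iInter.2 fun n => ?_⟩, hM⟩
  obtain ⟨F, hF⟩ := hA n
  have h1 : ∀ᶠ b in 𝓝 τ, ∀ z ∈ F, (x z).mark b = (x z).mark τ :=
    (Finset.eventually_all F).2 fun z _ =>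
      (hx z).eventually_mark_eq hM.1 fun k hk => hr ⟨(z, k), hk⟩
  obtain ⟨b, hb, hbt⟩ := ((mem_closure_iff_frequently.1 (mem_iInter.1 hτ n)).and_eventually h1).exists
  exact hF _ _ hbt hb.1.2

theorem dimH_compactTimes (hA : ∀ n, IsLocal (A n)) (M : ℕ) {x : Clocks}
    (hx : ∀ z, (x z).Good) :
    dimH (compactTimes A M x) = dimH (times (⋂ n, A n) x ∩ Icc 0 (M : ℝ)) := by
  refine le_antisymm ?_ (dimH_mono (times_inter_Icc_subset hA M hx))
  refine (dimH_mono (compactTimes_subset hA M hx)).trans ?_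
  rw [dimH_union, dimH_countable (countable_range _), max_eq_left zero_le]

theorem iSup_dimH_times_inter_Icc (A : Set Config) (x : Clocks) :
    ⨆ M : ℕ, dimH (times A x ∩ Icc 0 (M : ℝ)) = dimH (times A x) := by
  rw [← dimH_iUnion, ← inter_iUnion]
  congr 1
  refine inter_eq_left.2 fun τ hτ => ?_
  obtain ⟨M, hM⟩ := exists_nat_ge τ
  exact mem_iUnion.2 ⟨M, hτ.1, hM⟩

theorem measurable_dimH_compactTimes (hA : ∀ n, IsLocal (A n)) (hanti : Antitone A) (M : ℕ) :
    Measurable fun x => dimH (compactTimes A M x) := by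
  refine measurable_dimH_of_isCompact (isCompact_compactTimes M) fun U hU => ?_
  set F : Set ℝ := Icc 0 (M : ℝ) \ U with hFdef
  have hF : IsCompact F := isCompact_Icc.diff hU
  -- By compactness, being contained in `U` is already decided at one level `n`, with a uniform
  -- margin `(k + 1)⁻¹` around `F`. What remains concerns only rational times.
  have hsets : {x : Clocks | compactTimes A M x ⊆ U} = ⋃ (n : ℕ) (k : ℕ),
      ⋂ q : {q : ℚ // 0 ≤ q ∧ (q : ℝ) ∈ Metric.thickening ((k + 1 : ℝ)⁻¹) F},
        {x | x.arrows (q.1 : ℝ) ∈ A n}ᶜ := by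
    ext x
    simp only [mem_ofPred_eq, mem_iUnion, mem_iInter, mem_compl_iff, Subtype.forall]
    have hanti' : Antitone fun n => closure (ratTimes (A n) x) := fun m n hmn =>
      closure_mono fun τ hτ => ⟨⟨hτ.1.1, hanti hmn hτ.1.2⟩, hτ.2⟩
    constructor
    · intro hsub
      obtain ⟨n, hn⟩ := hF.elim_directed_family_closed
        (fun n => closure (ratTimes (A n) x)) (fun n => isClosed_closure) (by
          rw [eq_empty_iff_forall_notMem]
          rintro τ ⟨⟨h1, h2⟩, h3⟩
          exact h2 (hsub ⟨h1, h3⟩)) hanti'.directed_ge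
      obtain ⟨δ, hδ, hthick⟩ := hF.exists_thickening_subset_open
        (isClosed_closure (s := ratTimes (A n) x)).isOpen_compl
        (fun τ hτ hc => (eq_empty_iff_forall_notMem.1 hn τ) ⟨hτ, hc⟩)
      obtain ⟨k, hk⟩ := exists_nat_one_div_lt hδ
      rw [one_div] at hk
      refine ⟨n, k, fun q hq hqA => ?_⟩
      exact hthick (Metric.thickening_mono hk.le _ hq.2)
        (subset_closure ⟨⟨by exact_mod_cast hq.1, hqA⟩, q, rfl⟩)
    · rintro ⟨n, k, h⟩ τ ⟨hM, hτ⟩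
      by_contra hU'
      have hk : (0 : ℝ) < (k + 1 : ℝ)⁻¹ := by positivity
      obtain ⟨b, ⟨⟨hb0, hbA⟩, q, rfl⟩, hb⟩ := Metric.mem_closure_iff.1 (mem_iInter.1 hτ n) _ hk
      refine h q ⟨by exact_mod_cast hb0, ?_⟩ hbA
      exact Metric.mem_thickening_iff.2 ⟨τ, ⟨hM, hU'⟩, by rwa [dist_comm]⟩
  rw [hsets]
  exact MeasurableSet.iUnion fun n => MeasurableSet.iUnion fun k => MeasurableSet.iInter fun q =>
    (measurable_arrows _ (hA n).measurableSet).compl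

variable {u : Measure ℤˣ} [IsProbabilityMeasure u]

/-- The dimension of the set of times at which the configuration lies in a countable intersection
of local sets is almost surely constant. -/
theorem exists_ae_dimH_times_eq (hA : ∀ n, IsLocal (A n)) (hanti : Antitone A) :
    ∃ c, ∀ᵐ x ∂law u, dimH (times (⋂ n, A n) x) = c := by
  have hg : ∀ x : Clocks, (∀ z, (x z).Good) →
      ⨆ M : ℕ, dimH (compactTimes A M x) = dimH (times (⋂ n, A n) x) := fun x hx => by
    simp_rw [dimH_compactTimes hA _ hx, iSup_dimH_times_inter_Icc]
  obtain ⟨c, hc⟩ := exists_ae_eq_const (u := u)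
    (g := fun x => ⨆ M : ℕ, dimH (compactTimes A M x))
    (Measurable.iSup fun M => measurable_dimH_compactTimes hA hanti M) ENNReal.one_ne_top
    (fun x => iSup_le fun M => (dimH_mono (subset_univ _)).trans Real.dimH_univ.le)
    (fun a => by
      filter_upwards [ae_good (u := u),
        (measurePreserving_shift (u := u) a.cast_nonneg).quasiMeasurePreserving.ae ae_good]
        with x hx hx'
      rw [hg x hx, hg _ hx']
      exact dimH_times_shift_le hx a.cast_nonneg _)
  refine ⟨c, ?_⟩
  filter_upwards [hc, ae_good (u := u)] with x hx hgood
  rw [← hg x hgood, hx]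

end Clocks

end Arrows

/-! ### Confined paths and the initial zigzag. -/

theorem site_ext {z w : Site} (h1 : z.1.1 = w.1.1) (h2 : z.1.2 = w.1.2) : z = w :=
  Subtype.ext (Prod.ext h1 h2)

theorem walk_snd (ξ : Config) (z : Site) (n : ℕ) : (walk ξ z n).1.2 = z.1.2 + n := by
  induction n with
  | zero => simp [walk]
  | succ n ih => simp only [walk, next, ih]; push_cast; ring

theorem abs_walk_origin_fst_le (ξ : Config) (n : ℕ) : |(walk ξ origin n).1.1| ≤ n := by
  induction n with
  | zero => simp [walk, origin]
  | succ n ih =>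
    simp only [walk, next]; push_cast
    refine (abs_add_le _ _).trans (add_le_add ih ?_)
    rcases Int.units_eq_one_or (ξ (walk ξ origin n)) with h | h <;> simp [h]

theorem walk_add (ξ : Config) (z : Site) (a b : ℕ) :
    walk ξ z (a + b) = walk ξ (walk ξ z a) b := by
  induction b with
  | zero => rfl
  | succ b ih => rw [← add_assoc, walk, ih, walk]

theorem path_origin (ξ : Config) (t : ℝ) : path ξ origin t =
    ((walk ξ origin ⌊t⌋₊).1.1 : ℝ) + (t - ⌊t⌋₊) * ((ξ (walk ξ origin ⌊t⌋₊) : ℤ) : ℝ) := by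
  simp [path, origin]

/-- The arrow configurations whose path from the origin satisfies `|S t| ≤ j + K √t` for all
`t ≥ 0`. -/
def confined (j : ℕ) (K : ℝ) : Set Config :=
  {ξ | ∀ t : ℝ, 0 ≤ t → |path ξ origin t| ≤ j + K * √t}

/-- The confinement condition restricted to times before `n`. -/
def confinedUpTo (j : ℕ) (K : ℝ) (n : ℕ) : Set Config :=
  {ξ | ∀ t : ℝ, 0 ≤ t → t < n → |path ξ origin t| ≤ j + K * √t}

theorem iInter_confinedUpTo (j : ℕ) (K : ℝ) : ⋂ n, confinedUpTo j K n = confined j K := by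
  ext ξ
  rw [mem_iInter]
  refine ⟨fun h t ht => ?_, fun h n t ht _ => h t ht⟩
  obtain ⟨n, hn⟩ := exists_nat_gt t
  exact h n t ht hn

theorem antitone_confinedUpTo (j : ℕ) (K : ℝ) : Antitone (confinedUpTo j K) :=
  fun _ _ hmn _ h t ht htm => h t ht (htm.trans_le (Nat.cast_le.2 hmn))

theorem isLocal_confinedUpTo (j : ℕ) (K : ℝ) (n : ℕ) : IsLocal (confinedUpTo j K n) := by
  -- The path has speed one, so before time `n` it sees only arrows in this box.
  refine ⟨(Finset.Icc (-(n : ℤ)) n ×ˢ Finset.Icc (0 : ℤ) n).subtype _, fun ξ η hF hξ t ht htn => ?_⟩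
  have hmem : ∀ k ≤ n, ξ (walk ξ origin k) = η (walk ξ origin k) := fun k hk => by
    refine hF _ ?_
    have h1 := abs_le.1 (abs_walk_origin_fst_le ξ k)
    have h2 := walk_snd ξ origin k
    have h3 : origin.1.2 = 0 := rfl
    rw [Finset.mem_subtype, Finset.mem_product, Finset.mem_Icc, Finset.mem_Icc]
    refine ⟨⟨?_, ?_⟩, ?_, ?_⟩ <;> omega
  have hwalk : ∀ k ≤ n, walk ξ origin k = walk η origin k := fun k => by
    induction k with
    | zero => exact fun _ => rfl
    | succ k ih =>
      intro hk
      have h1 := hmem k (by omega)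
      rw [walk, walk, ← ih (by omega)]
      exact site_ext (by simp [next, h1]) (by simp [next])
  have hfl : ⌊t⌋₊ ≤ n := Nat.floor_le_of_le htn.le
  have := hξ t ht htn
  rwa [path_origin, hmem _ hfl, hwalk _ hfl, ← path_origin] at this

theorem confined_mono {j j' : ℕ} {K K' : ℝ} (hj : j ≤ j') (hK : K ≤ K') :
    confined j K ⊆ confined j' K' := fun _ h t ht => (h t ht).trans
  (add_le_add (Nat.cast_le.2 hj) (mul_le_mul_of_nonneg_right hK (Real.sqrt_nonneg t)))

theorem confined_of_neg (j : ℕ) {K : ℝ} (hK : K < 0) : confined j K = ∅ := by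
  rw [eq_empty_iff_forall_notMem]
  intro ξ h
  -- At `√t = (j + 1) / -K` the bound equals `-1`.
  have hs : 0 ≤ (j + 1) / -K := div_nonneg (by positivity) (by linarith)
  have h1 := (abs_nonneg _).trans (h (((j + 1) / -K) ^ 2) (sq_nonneg _))
  rw [Real.sqrt_sq hs, div_neg, mul_neg, mul_div_cancel₀ _ hK.ne] at h1
  linarith

/-- The translation by `2 m` time steps of the sites at nonnegative times; the other sites are left
in place. -/
def translate (m : ℕ) (z : Site) : Site := ⟨(z.1.1, if 0 ≤ z.1.2 then z.1.2 + 2 * m else z.1.2), by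
  have := z.2
  split_ifs
  · rw [← add_assoc]; exact this.add (even_two_mul _)
  · exact this⟩

theorem translate_snd {m : ℕ} {z : Site} (hz : 0 ≤ z.1.2) :
    (translate m z).1.2 = z.1.2 + 2 * m := if_pos hz

theorem walk_translate (ξ : Config) (m : ℕ) {z : Site} (hz : 0 ≤ z.1.2) (n : ℕ) :
    walk ξ (translate m z) n = translate m (walk (ξ ∘ translate m) z n) := by
  induction n with
  | zero => rfl
  | succ n ih =>
    have h0 : 0 ≤ (walk (ξ ∘ translate m) z n).1.2 := by rw [walk_snd]; omega
    have h1 : 0 ≤ (walk (ξ ∘ translate m) z (n + 1)).1.2 := by rw [walk_snd]; omega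
    refine site_ext ?_ ?_
    · rw [walk, ih]; rfl
    · rw [translate_snd h1, walk, ih]
      simp only [next, walk, translate_snd h0]; ring

/-- The sites of the path that alternates between positions `0` and `1`. -/
def zigzag (i : ℕ) : Site := ⟨((i : ℤ) % 2, i), by
  rcases Int.even_or_odd (i : ℤ) with h | h
  · simpa [Int.even_iff.1 h] using h
  · rw [Int.odd_iff.1 h, add_comm]; exact h.add_one⟩

theorem zigzag_fst (i : ℕ) : (zigzag i).1.1 = (i : ℤ) % 2 := rfl

theorem walk_eq_zigzag {ξ : Config} {n : ℕ} (h : ∀ i < n, ξ (zigzag i) = (-1) ^ i) :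
    ∀ i ≤ n, walk ξ origin i = zigzag i := by
  intro i
  induction i with
  | zero => exact fun _ => rfl
  | succ i ih =>
    intro hi
    rw [walk, ih (by omega)]
    refine site_ext ?_ (by simp [next, zigzag])
    simp only [next, h i (by omega), zigzag_fst]
    rcases Nat.even_or_odd i with h2 | h2
    · have := Nat.even_iff.1 h2
      rw [h2.neg_one_pow]; push_cast; omega
    · have := Nat.odd_iff.1 h2
      rw [h2.neg_one_pow]; push_cast; omega

/-- A zigzag followed by a translated confined path is confined by a steeper parabola. -/
theorem mem_confined_of_zigzag {ξ : Config} {j m : ℕ} {K K' : ℝ} (hK : 0 ≤ K) (hKK : K < K')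
    (hm : j ≤ (K' - K) * √(2 * m)) (h : ∀ i < 2 * m, ξ (zigzag i) = (-1) ^ i)
    (hξ : ξ ∘ translate m ∈ confined j K) : ξ ∈ confined 1 K' := by
  intro t ht
  have hw := walk_eq_zigzag h
  have hfl1 := Nat.floor_le ht
  have hfl2 := (Nat.lt_floor_add_one t).le
  by_cases hn : ⌊t⌋₊ < 2 * m
  · have h1 : |path ξ origin t| ≤ 1 := by
      rw [path_origin, hw _ hn.le, h _ hn, abs_le]
      rcases Nat.even_or_odd ⌊t⌋₊ with h2 | h2
      · have h3 : ((⌊t⌋₊ : ℤ) % 2) = 0 := by have := Nat.even_iff.1 h2; omega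
        rw [h2.neg_one_pow, zigzag_fst, h3]; push_cast
        constructor <;> linarith
      · have h3 : ((⌊t⌋₊ : ℤ) % 2) = 1 := by have := Nat.odd_iff.1 h2; omega
        rw [h2.neg_one_pow, zigzag_fst, h3]; push_cast
        constructor <;> linarith
    refine h1.trans ?_
    have : 0 ≤ K' * √t := mul_nonneg (by linarith) (Real.sqrt_nonneg t)
    push_cast; linarith
  · push Not at hn
    have htm : (2 * m : ℝ) ≤ t := le_trans (by exact_mod_cast hn) hfl1
    -- After the even number `2 * m` of steps the zigzag is back at position `0`, where the
    -- translated path starts.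
    have hw2 : walk ξ origin ⌊t⌋₊ =
        translate m (walk (ξ ∘ translate m) origin (⌊t⌋₊ - 2 * m)) := by
      conv_lhs => rw [← Nat.add_sub_cancel' hn]
      rw [walk_add, hw _ le_rfl, ← walk_translate _ _ (z := origin) le_rfl]
      congr 1
      exact site_ext (by simp [zigzag, translate, origin]) (by simp [zigzag, translate, origin])
    have hfloor : ⌊t - 2 * m⌋₊ = ⌊t⌋₊ - 2 * m := by
      have := Nat.floor_sub_natCast t (2 * m)
      push_cast at this; exact this
    have hpath : path ξ origin t = path (ξ ∘ translate m) origin (t - 2 * m) := by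
      rw [path_origin, path_origin, hfloor, hw2, Nat.cast_sub hn]
      simp only [translate, Function.comp]
      push_cast; ring
    rw [hpath]
    refine (hξ (t - 2 * m) (by linarith)).trans ?_
    have h1 : K * √(t - 2 * m) ≤ K * √t :=
      mul_le_mul_of_nonneg_left (Real.sqrt_le_sqrt (by linarith [m.cast_nonneg (α := ℝ)])) hK
    -- With `hm` this shows that the gain in slope exceeds `j` from time `2 * m` on.
    have h2 : (K' - K) * √(2 * m) ≤ (K' - K) * √t :=
      mul_le_mul_of_nonneg_left (Real.sqrt_le_sqrt htm) (by linarith)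
    push_cast
    linarith

/-! ### Comparison of the almost sure dimensions. -/

namespace Clocks

variable {u : Measure ℤˣ} [IsProbabilityMeasure u]

/-- The zigzag visits distinct sites, so this is a finite product of positive probabilities: no ring
up to time `M`, and the prescribed initial sign. -/
theorem law_zigzag_ne_zero (hu : ∀ v, u {v} ≠ 0) (n M : ℕ) :
    law u {x | ∀ i : Fin n, (M : ℝ) < (x (zigzag i) 0).1 ∧ (x (zigzag i) 0).2 = (-1) ^ (i : ℕ)}
      ≠ 0 := by
  let S : Fin n → Set Clock := fun i => {e | e 0 ∈ Ioi (M : ℝ) ×ˢ {(-1) ^ (i : ℕ)}}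
  have hE : ∀ v : ℤˣ, MeasurableSet (Ioi (M : ℝ) ×ˢ {v}) := fun v =>
    measurableSet_Ioi.prod (measurableSet_singleton v)
  have hS : ∀ i, MeasurableSet (S i) := fun i => measurable_pi_apply 0 (hE _)
  have hinj : Function.Injective fun i : Fin n => zigzag i := fun i k h => by
    have : ((i : ℕ) : ℤ) = (k : ℕ) := congrArg (fun z : Site => z.1.2) h
    exact Fin.ext (by exact_mod_cast this)
  have hmap := Measure.map_infinitePi_infinitePi_of_inj (P := fun _ : Site => Clock.law u) hinj
  have hset : {x : Clocks | ∀ i : Fin n, (M : ℝ) < (x (zigzag i) 0).1 ∧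
      (x (zigzag i) 0).2 = (-1) ^ (i : ℕ)} = (fun x (i : Fin n) => x (zigzag i)) ⁻¹' Set.pi univ S := by
    ext x; simp [S, Set.mem_pi]
  rw [hset, law, ← Measure.map_apply (by fun_prop) (MeasurableSet.univ_pi hS), hmap,
    infinitePi_univ_pi (s := Finset.univ) _ hS (by simp), Finset.prod_ne_zero_iff]
  intro i _
  rw [Clock.law_eval 0 (hE _), Measure.prod_prod, expMeasure_Ioi M.cast_nonneg]
  exact mul_ne_zero (by simp [Real.exp_pos]) (hu _)

/-- The translation is injective on sites: moved sites keep nonnegative times, unmoved ones negative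
times. Reindexing an i.i.d. family injectively preserves its law. -/
theorem measurePreserving_translate (m : ℕ) :
    MeasurePreserving (fun (x : Clocks) z => x (translate m z)) (law u) (law u) := by
  refine ⟨by fun_prop, Measure.map_infinitePi_infinitePi_of_inj (P := fun _ : Site => Clock.law u)
    (f := translate m) fun z w h => ?_⟩
  have h1 := congrArg (fun z : Site => z.1.1) h
  have h2 := congrArg (fun z : Site => z.1.2) h
  simp only [translate] at h1 h2
  exact site_ext h1 (by split_ifs at h2 <;> omega)

theorem arrows_zigzag {x : Clocks} (hx : ∀ z, (x z).Good) {i M : ℕ} {v : ℤˣ}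
    (h : (M : ℝ) < (x (zigzag i) 0).1 ∧ (x (zigzag i) 0).2 = v) {τ : ℝ} (hτ : 0 ≤ τ) (hM : τ ≤ M) :
    x.arrows τ (zigzag i) = v := by
  have : Clock.count τ (x (zigzag i)) = 0 := by
    rw [(hx _).count_eq_iff hτ, Clock.time_succ, Clock.time_zero, zero_add]
    exact ⟨hτ, hM.trans_lt h.1⟩
  rw [arrows, Clock.mark, this, h.2]

/-- Widening the parabola compensates for an additive constant in the confinement condition. -/
theorem dimH_confined_le (hu : ∀ v, u {v} ≠ 0) {j : ℕ} {K K' : ℝ} (hKK : K < K') {c c' : ℝ≥0∞}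
    (hc : ∀ᵐ x ∂law u, dimH (times (confined j K) x) = c)
    (hc' : ∀ᵐ x ∂law u, dimH (times (confined 1 K') x) = c') : c ≤ c' := by
  rcases lt_or_ge K 0 with hK | hK
  · obtain ⟨x, hx⟩ := hc.exists
    have : times (confined j K) x = ∅ := by
      rw [confined_of_neg j hK]; ext τ; simp [times]
    rw [← hx, this, dimH_empty]; exact zero_le
  by_contra! hlt
  obtain ⟨m, hm⟩ : ∃ m : ℕ, (j : ℝ) ≤ (K' - K) * √(2 * m) := by
    obtain ⟨m, hm⟩ := exists_nat_ge ((j / (K' - K)) ^ 2)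
    refine ⟨m, ?_⟩
    have hpos : 0 < K' - K := by linarith
    rw [mul_comm, ← div_le_iff₀ hpos]
    refine Real.le_sqrt_of_sq_le (hm.trans ?_)
    have := m.cast_nonneg (α := ℝ); linarith
  have hloc := isLocal_confinedUpTo j K
  -- The zigzag can be frozen with positive probability only over a bounded range of `τ`, hence the
  -- restriction to `[0, M]`; the compact version makes the event measurable.
  let H : ℕ → Set Clocks := fun M => {x | c' < dimH (compactTimes (confinedUpTo j K) M x)}
  have hH : ∀ M, MeasurableSet (H M) := fun M => measurableSet_lt measurable_const
    (measurable_dimH_compactTimes hloc (antitone_confinedUpTo j K) M)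
  obtain ⟨M, hM⟩ : ∃ M, law u (H M) ≠ 0 := by
    by_contra! h0
    have h1 : ∀ᵐ x ∂law u, x ∉ ⋃ M, H M :=
      measure_eq_zero_iff_ae_notMem.1 (measure_iUnion_null h0)
    obtain ⟨x, hx1, hx2, hx3⟩ := (h1.and (hc.and ae_good)).exists
    rw [← iSup_dimH_times_inter_Icc] at hx2
    rw [← hx2, lt_iSup_iff] at hlt
    obtain ⟨M, hM⟩ := hlt
    refine hx1 (mem_iUnion.2 ⟨M, ?_⟩)
    change c' < _
    rwa [dimH_compactTimes hloc M hx3, iInter_confinedUpTo]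
  let G' : Set (Fin (2 * m) → Clock) :=
    {y | ∀ i, (M : ℝ) < (y i 0).1 ∧ (y i 0).2 = (-1) ^ (i : ℕ)}
  have hG' : MeasurableSet G' := by
    simp only [G', ofPred_forall]
    refine MeasurableSet.iInter fun i => MeasurableSet.inter ?_ ?_
    · exact measurableSet_lt measurable_const
        (by fun_prop : Measurable fun y : Fin (2 * m) → Clock => (y i 0).1)
    · exact (measurableSet_singleton ((-1 : ℤˣ) ^ (i : ℕ))).preimage
        (by fun_prop : Measurable fun y : Fin (2 * m) → Clock => (y i 0).2)
  -- The zigzag uses times `0` to `2 * m - 1`, which the translation avoids.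
  have hind : IndepFun (fun (x : Clocks) (i : Fin (2 * m)) => x (zigzag i))
      (fun (x : Clocks) z => x (translate m z)) (law u) := by
    refine indepFun_of_disjoint_range (X := fun (z : Site) (x : Clocks) => x z) (fun z => measurable_pi_apply z)
      (iIndepFun_infinitePi (X := fun _ x => x) fun _ => measurable_id)
      (f := fun i : Fin (2 * m) => zigzag i) (g := translate m) fun i z h => ?_
    have h2 : ((i : ℕ) : ℤ) = _ := congrArg (fun z : Site => z.1.2) h
    have h3 := i.2
    simp only [translate] at h2
    split_ifs at h2 <;> omega
  have hpos : law u ((fun (x : Clocks) (i : Fin (2 * m)) => x (zigzag i)) ⁻¹' G' ∩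
      (fun (x : Clocks) z => x (translate m z)) ⁻¹' H M) ≠ 0 := by
    rw [hind.measure_inter_preimage_eq_mul _ _ hG' (hH M),
      (measurePreserving_translate m).measure_preimage (hH M).nullMeasurableSet]
    exact mul_ne_zero (law_zigzag_ne_zero hu (2 * m) M) hM
  have hfr : ∃ᵐ x ∂law u, x ∈ (fun (x : Clocks) (i : Fin (2 * m)) => x (zigzag i)) ⁻¹' G' ∩
      (fun (x : Clocks) z => x (translate m z)) ⁻¹' H M := by
    rwa [frequently_ae_mem_iff]
  -- An event of positive probability meets the almost sure ones, and one common realization gives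
  -- the contradiction.
  obtain ⟨x, ⟨hxG, hxH⟩, hx1, hx2⟩ := (hfr.and_eventually (hc'.and ae_good)).exists
  have hxH' : c' < dimH (compactTimes (confinedUpTo j K) M fun z => x (translate m z)) := hxH
  rw [dimH_compactTimes hloc M fun z => hx2 _, iInter_confinedUpTo, ← hx1] at hxH'
  refine hxH'.not_ge (dimH_mono ?_)
  rintro τ ⟨⟨h0, hτ⟩, hτM⟩
  exact ⟨h0, mem_confined_of_zigzag hK hKK hm
    (fun i hi => arrows_zigzag hx2 (hxG ⟨i, hi⟩) h0 hτM.2) hτ⟩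

end Clocks

/-! ### From an abstract dynamical web to the product law. -/

namespace DynamicalWeb

variable {Ω : Type*} [MeasurableSpace Ω] {P : Measure Ω}

/-- The clocks of a dynamical web. -/
def clocks (W : DynamicalWeb P) (ω : Ω) : Clocks := fun z n => (W.wait z n ω, W.mark z n ω)

/-- Joint independence and the marginals determine the law, so every almost sure statement about
product clocks transfers to `P`. -/
theorem measurePreserving_clocks [IsProbabilityMeasure P] (W : DynamicalWeb P) :
    MeasurePreserving W.clocks P (Clocks.law (P.map (W.mark origin 0))) := by
  set u := P.map (W.mark origin 0) with hu
  have hprob : IsProbabilityMeasure u :=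
    Measure.isProbabilityMeasure_map (W.measurable_mark _ _).aemeasurable
  have hmark : ∀ z n, P.map (W.mark z n) = u := fun z n => by
    refine Measure.ext_of_singleton fun v => ?_
    rw [hu, Measure.map_apply (W.measurable_mark _ _) (measurableSet_singleton v),
      Measure.map_apply (W.measurable_mark _ _) (measurableSet_singleton v)]
    exact (W.law_mark z n v).trans (W.law_mark origin 0 v).symm
  have hpm : ∀ p : Site × ℕ, Measurable fun ω => (W.wait p.1 p.2 ω, W.mark p.1 p.2 ω) :=
    fun p => (W.measurable_wait _ _).prodMk (W.measurable_mark _ _)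
  have hpair : ∀ p : Site × ℕ, P.map (fun ω => (W.wait p.1 p.2 ω, W.mark p.1 p.2 ω)) =
      (expMeasure 1).prod u := fun p => by
    rw [(W.indep_wait_mark p.1 p.2).map_prod_eq_prod_map_map (W.measurable_wait _ _).aemeasurable
      (W.measurable_mark _ _).aemeasurable, W.law_wait, hmark]
  have h1 := W.indep.map_fun_eq_infinitePi_map hpm
  simp_rw [hpair] at h1
  have h2 := Measure.infinitePi_map_curry fun (_ : Site) (_ : ℕ) => (expMeasure 1).prod u
  rw [← h1, Measure.map_map (MeasurableEquiv.measurable _) (measurable_pi_lambda _ hpm)] at h2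
  exact ⟨measurable_pi_lambda _ fun z => measurable_pi_lambda _ fun n => hpm (z, n), h2⟩

theorem T_eq_times (W : DynamicalWeb P) {ω : Ω} (h : ∀ z, (W.clocks ω z).Good) (j : ℕ) (K : ℝ) :
    W.T j K ω = (W.clocks ω).times (confined j K) := by
  ext τ
  refine and_congr_right fun h0 => ?_
  have : W.arrows τ ω = (W.clocks ω).arrows τ := by
    funext z
    have : W.ringCount z τ ω = Clock.count τ (W.clocks ω z) := (h z).ncard_eq_count h0
    simp only [arrows, this]; rfl
  simp only [S₀, this]; rfl

end DynamicalWeb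

end DiscreteWeb

/-! ### The main theorem. -/

open DiscreteWeb

theorem mainTheorem9 {Ω : Type*} [MeasurableSpace Ω] (P : Measure Ω) [IsProbabilityMeasure P]
    (W : DiscreteWeb.DynamicalWeb P) :
    ∃ (d : ℕ → ℝ → ℝ≥0∞) (dInf : ℝ → ℝ≥0∞),
      (∀ (j : ℕ) (K : ℝ), ∀ᵐ ω ∂P, dimH (W.T j K ω) = d j K) ∧
      (∀ K : ℝ, ∀ᵐ ω ∂P, dimH (W.TInf K ω) = dInf K) ∧
      (∀ K : ℝ, (⨆ K' ∈ Iio K, dInf K') ≤ d 1 K ∧ d 1 K ≤ dInf K ∧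
        dInf K ≤ ⨅ K'' ∈ Ioi K, d 1 K'') ∧
      {K : ℝ | ∃ j : ℕ, 1 ≤ j ∧ d j K ≠ dInf K}.Countable := by
  have hmp := W.measurePreserving_clocks
  set u := P.map (W.mark origin 0) with hu
  have hprob : IsProbabilityMeasure u :=
    Measure.isProbabilityMeasure_map (W.measurable_mark _ _).aemeasurable
  have hu0 : ∀ v, u {v} ≠ 0 := fun v => by
    rw [hu, Measure.map_apply (W.measurable_mark _ _) (measurableSet_singleton v)]
    have : P (W.mark origin 0 ⁻¹' {v}) = 1 / 2 := W.law_mark origin 0 v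
    rw [this]; simp
  have hconst : ∀ (j : ℕ) (K : ℝ), ∃ c, ∀ᵐ x ∂Clocks.law u,
      dimH (Clocks.times (confined j K) x) = c := fun j K => by
    rw [← iInter_confinedUpTo]
    exact Clocks.exists_ae_dimH_times_eq (isLocal_confinedUpTo j K) (antitone_confinedUpTo j K)
  choose d hd using hconst
  have hmono : ∀ {j j' : ℕ} {K K' : ℝ}, j ≤ j' → K ≤ K' → d j K ≤ d j' K' :=
    fun {j j' K K'} hj hK => by
      obtain ⟨x, h1, h2⟩ := ((hd j K).and (hd j' K')).exists
      rw [← h1, ← h2]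
      exact dimH_mono fun τ hτ => ⟨hτ.1, confined_mono hj hK hτ.2⟩
  have hkey : ∀ {K K' : ℝ}, K < K' → ⨆ j, d j K ≤ d 1 K' := fun {K K'} hKK =>
    iSup_le fun j => Clocks.dimH_confined_le hu0 hKK (hd j K) (hd 1 K')
  have hT : ∀ (j : ℕ) (K : ℝ), ∀ᵐ ω ∂P, dimH (W.T j K ω) = d j K := fun j K => by
    filter_upwards [hmp.quasiMeasurePreserving.ae (hd j K),
      hmp.quasiMeasurePreserving.ae Clocks.ae_good] with ω h1 h2
    rw [W.T_eq_times h2, h1]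
  -- Countable stability of Hausdorff dimension dictates the supremum as the value of `dInf`.
  refine ⟨d, fun K => ⨆ j, d j K, hT, fun K => ?_, fun K => ⟨?_, ?_, ?_⟩, ?_⟩
  · filter_upwards [ae_all_iff.2 fun j => hT j K] with ω h
    rw [DynamicalWeb.TInf, dimH_iUnion]
    exact iSup_congr h
  · exact iSup₂_le fun K' hK' => hkey hK'
  · exact le_iSup (fun j => d j K) 1
  · exact le_iInf₂ fun K' hK' => hkey hK'
  · have hf : Monotone (d 1) := fun K K' h => hmono le_rfl h
    refine hf.countable_not_continuousAt.mono ?_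
    -- At a continuity point of `d 1`, letting `K'` decrease to `K` in `hkey` gives `dInf K ≤ d 1 K
    -- ≤ d j K`, using `1 ≤ j`.
    rintro K ⟨j, hj, hne⟩ hcont
    refine hne (le_antisymm (le_iSup (fun j => d j K) j) (le_trans ?_ (hmono hj le_rfl)))
    refine ge_of_tendsto (hcont.tendsto.mono_left (nhdsWithin_le_nhds (s := Ioi K))) ?_
    filter_upwards [self_mem_nhdsWithin] with K' hK' using hkey hK'
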